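/- Let $k$ be an algebraically closed field and let $Z$ be a Poisson $k$-algebra (a commutative $k$-algebra with a $k$-bilinear Lie bracket $\{\cdot,\cdot\}$ that is a derivation in each argument) which is affine (reduced and finitely generated over $k$) and regular (every localisation at a prime ideal is a regular local ring). Let $A$ be a Poisson order over $Z$: a $Z$-algebra, not necessarily commutative, that is finitely generated as a $Z$-module, with a $k$-bilinear map $Z\times A\to A$, $(x,a)\mapsto\{x,a\}=H(x)a$, extending the Poisson bracket of $Z$ (that is, $\{x,y1_A\}=\{x,y\}1_A$ for $x,y\in Z$), such that each $H(x)$ is a derivation of $A$ and $H(xy)=xH(y)+yH(x)$. Assume moreover that $A$ is a Poisson module over itself through $H$, that is, $H(\{x,y\})=[H(x),H(y)]$ on $A$ for all $x,y\in Z$. Let $A^e$ be the Poisson enveloping algebra of $A$: the $k$-algebra generated by symbols $\alpha(a)$ $(a\in A)$ and $\delta(z)$ $(z\in Z)$ subject to the relations that $\alpha$ is a homomorphism of unital $k$-algebras, $\delta$ is a homomorphism of Lie algebras over $k$, $\alpha(\{x,a\})=[\delta(x),\alpha(a)]$ and $\delta(xy)=\alpha(x1_A)\delta(y)+\alpha(y1_A)\delta(x)$.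 Let $Z^e$ be the enveloping algebra of $Z$ as a Poisson order over itself, and let $\iota\colon Z^e\to A^e$ be the natural homomorphism $\alpha(z)\mapsto\alpha(z1_A)$, $\delta(z)\mapsto\delta(z)$. The PBW filtration $(\mathcal F_nA^e)_{n\ge 0}$ has $\mathcal F_nA^e$ spanned by the products of generators with at most $n$ factors of the form $\delta(z)$; put $\mathcal F_{-1}A^e=0$ and $\operatorname{gr}A^e=\bigoplus_{n\ge0}\mathcal F_nA^e/\mathcal F_{n-1}A^e$. Let $\Omega_{Z/k}$ be the module of Kähler differentials. Then: 1. There is a unique homomorphism of $k$-algebras $A\otimes_Z S_Z(\Omega_{Z/k})\to\operatorname{gr}A^e$ sending $a\otimes1$ to the class of $\alpha(a)$ in degree $0$ and $1\otimes dz$ to the class of $\delta(z)$ in degree $1$, and it is an isomorphism. 2. The map $A\otimes_ZZ^e\to A^e$, $a\otimes u\mapsto\alpha(a)\iota(u)$, is a well-defined isomorphism of $(A,Z^e)$-bimodules. 3. The map $Z^e\otimes_ZA\to A^e$, $u\otimes a\mapsto\iota(u)\alpha(a)$, is a well-defined isomorphism of $(Z^e,A)$-bimodules. -/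

import Mathlib

open scoped TensorProduct DirectSum KaehlerDifferential

/-! ### Poisson algebras and Poisson orders -/

/-- A Poisson algebra over `k`: a commutative `k`-algebra `Z` with a `k`-bilinear bracket that
makes `Z` into a Lie algebra and is a derivation in each argument (the derivation property in the
first argument follows from the one in the second, as the bracket is alternating). -/
class PoissonAlgebra (k Z : Type*) [Field k] [CommRing Z] [Algebra k Z] where
  /-- The Poisson bracket `{x, y}`. -/
  bracket : Z →ₗ[k] Z →ₗ[k] Z
  bracket_self : ∀ x, bracket x x = 0
  jacobi : ∀ x y z,
    bracket x (bracket y z) + bracket y (bracket z x) + bracket z (bracket x y) = 0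
  leibniz : ∀ x y z, bracket x (y * z) = bracket x y * z + y * bracket x z

/-- A Poisson order over the Poisson algebra `Z`: a `Z`-algebra `A`, of finite type as a
`Z`-module, with an extension `Z × A → A`, `(x, a) ↦ {x, a} = H(x) a`, of the Poisson bracket to a
biderivation. -/
class PoissonOrder (k Z A : Type*) [Field k] [CommRing Z] [Algebra k Z] [PoissonAlgebra k Z]
    [Ring A] [Algebra k A] [Algebra Z A] [IsScalarTower k Z A] where
  finite : Module.Finite Z A
  /-- The Hamiltonian derivations: `ham x a = {x, a}`. -/
  ham : Z →ₗ[k] A →ₗ[k] A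
  ham_algebraMap : ∀ x y : Z,
    ham x (algebraMap Z A y) = algebraMap Z A (PoissonAlgebra.bracket (k := k) x y)
  ham_mul : ∀ (x : Z) (a b : A), ham x (a * b) = ham x a * b + a * ham x b
  mul_ham : ∀ (x y : Z) (a : A), ham (x * y) a = x • ham y a + y • ham x a

/-- A Poisson algebra is a Poisson order over itself. -/
instance PoissonOrder.self (k Z : Type*) [Field k] [CommRing Z] [Algebra k Z]
    [PoissonAlgebra k Z] : PoissonOrder k Z Z where
  finite := inferInstance
  ham := PoissonAlgebra.bracket (k := k)
  ham_algebraMap _ _ := rfl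
  ham_mul := PoissonAlgebra.leibniz
  mul_ham x y a := by
    have skew : ∀ u v : Z, PoissonAlgebra.bracket (k := k) u v = - PoissonAlgebra.bracket (k := k) v u := by
      intro u v
      have h := PoissonAlgebra.bracket_self (k := k) (u + v)
      simp only [map_add, LinearMap.add_apply, PoissonAlgebra.bracket_self, zero_add,
        add_zero] at h
      exact eq_neg_of_add_eq_zero_right h
    rw [skew (x * y) a, PoissonAlgebra.leibniz, skew a x, skew a y]
    simp only [smul_eq_mul]
    ring

theorem PoissonOrder.ham_self (k Z : Type*) [Field k] [CommRing Z] [Algebra k Z]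
    [PoissonAlgebra k Z] (x y : Z) :
    PoissonOrder.ham (k := k) x y = PoissonAlgebra.bracket (k := k) x y := rfl

/-! ### The associated graded algebra of a filtered algebra -/

namespace FilteredAlgebra

variable {k R : Type*} [Field k] [Ring R] [Algebra k R]

/-- For a filtration `F 0 ≤ F 1 ≤ ⋯`, the submodule preceding `F i`; here `F (-1) = 0`. -/
def lt (F : ℕ → Submodule k R) : ℕ → Submodule k R
  | 0 => ⊥
  | n + 1 => F n

/-- A filtration of a `k`-algebra, indexed by the natural numbers. -/
class IsFilt (F : ℕ → Submodule k R) : Prop where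
  mono : Monotone F
  one_mem : (1 : R) ∈ F 0
  mul_mem : ∀ {i j : ℕ} {x y : R}, x ∈ F i → y ∈ F j → x * y ∈ F (i + j)

/-- The homogeneous component `F i / F (i - 1)`. -/
def Piece (F : ℕ → Submodule k R) (i : ℕ) : Type _ := F i ⧸ (lt F i).submoduleOf (F i)

instance (F : ℕ → Submodule k R) (i : ℕ) : AddCommGroup (Piece F i) :=
  inferInstanceAs (AddCommGroup (F i ⧸ (lt F i).submoduleOf (F i)))

instance (F : ℕ → Submodule k R) (i : ℕ) : Module k (Piece F i) :=
  inferInstanceAs (Module k (F i ⧸ (lt F i).submoduleOf (F i)))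

/-- The associated graded algebra `⨁ i, F i / F (i - 1)`. -/
abbrev Gr (F : ℕ → Submodule k R) : Type _ := ⨁ i, Piece F i

/-- The class of `x ∈ F i` in `F i / F (i - 1)`. -/
def cls (F : ℕ → Submodule k R) {i : ℕ} (x : R) (hx : x ∈ F i) : Piece F i :=
  Submodule.Quotient.mk ⟨x, hx⟩

theorem cls_eq (F : ℕ → Submodule k R) {i : ℕ} {x y : R} (hx : x ∈ F i) (hy : y ∈ F i)
    (h : x - y ∈ lt F i) : cls F x hx = cls F y hy :=
  (Submodule.Quotient.eq _).2 h

theorem exists_cls (F : ℕ → Submodule k R) {i : ℕ} (a : Piece F i) :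
    ∃ (x : R) (hx : x ∈ F i), a = cls F x hx := by
  obtain ⟨⟨x, hx⟩, rfl⟩ := Submodule.Quotient.mk_surjective _ a
  exact ⟨x, hx, rfl⟩

theorem mk_cls_eq (F : ℕ → Submodule k R) {i j : ℕ} {x y : R} (hx : x ∈ F i) (hy : y ∈ F j)
    (hij : i = j) (hxy : x = y) :
    GradedMonoid.mk (A := Piece F) i (cls F x hx) = GradedMonoid.mk j (cls F y hy) := by
  subst hij; subst hxy; rfl

variable (F : ℕ → Submodule k R) [IsFilt F]

theorem mul_lt_mem {i j : ℕ} {x y : R} (hx : x ∈ F i) (hy : y ∈ lt F j) :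
    x * y ∈ lt F (i + j) := by
  cases j with
  | zero =>
    have : y = 0 := by simpa [lt] using hy
    simp [this]
  | succ n => exact IsFilt.mul_mem (F := F) hx hy

theorem lt_mul_mem {i j : ℕ} {x y : R} (hx : x ∈ lt F i) (hy : y ∈ F j) :
    x * y ∈ lt F (i + j) := by
  cases i with
  | zero =>
    have : x = 0 := by simpa [lt] using hx
    simp [this]
  | succ n =>
    have h := IsFilt.mul_mem (F := F) (i := n) hx hy
    rw [Nat.add_right_comm]
    exact h

/-- The product `F i / F (i - 1) × F j / F (j - 1) → F (i + j) / F (i + j - 1)` induced by the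
multiplication of the algebra. -/
def pieceMul {i j : ℕ} (a : Piece F i) (b : Piece F j) : Piece F (i + j) :=
  Quotient.map₂ (fun x y => (⟨x.1 * y.1, IsFilt.mul_mem x.2 y.2⟩ : F (i + j)))
    (fun x x' hx y y' hy => by
      have hx' : (x : R) - x' ∈ lt F i := (Submodule.quotientRel_def (lt F i |>.submoduleOf (F i))).1 hx
      have hy' : (y : R) - y' ∈ lt F j := (Submodule.quotientRel_def (lt F j |>.submoduleOf (F j))).1 hy
      refine (Submodule.quotientRel_def _).2 ?_
      change (x : R) * y - x' * y' ∈ lt F (i + j)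
      have e : (x : R) * y - x' * y' = x * (y - y') + (x - x') * y' := by
        rw [mul_sub, sub_mul]; abel
      rw [e]
      exact add_mem (mul_lt_mem F x.2 hy') (lt_mul_mem F hx' y'.2)) a b

theorem pieceMul_cls {i j : ℕ} {x y : R} (hx : x ∈ F i) (hy : y ∈ F j) :
    pieceMul F (cls F x hx) (cls F y hy) = cls F (x * y) (IsFilt.mul_mem hx hy) := rfl

theorem algebraMap_mem (c : k) : algebraMap k R c ∈ F 0 := by
  rw [Algebra.algebraMap_eq_smul_one]
  exact (F 0).smul_mem c IsFilt.one_mem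

instance gMul : GradedMonoid.GMul (Piece F) := ⟨pieceMul F⟩

instance gOne : GradedMonoid.GOne (Piece F) := ⟨cls F 1 IsFilt.one_mem⟩

instance gRing : DirectSum.GRing (Piece F) where
  __ := gMul F
  __ := gOne F
  mul_zero := by
    intro i j a
    obtain ⟨x, hx, rfl⟩ := exists_cls F a
    exact cls_eq F (x := x * 0) (y := 0) _ (zero_mem _) (by simp)
  zero_mul := by
    intro i j a
    obtain ⟨x, hx, rfl⟩ := exists_cls F a
    exact cls_eq F (x := 0 * x) (y := 0) _ (zero_mem _) (by simp)
  mul_add := by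
    intro i j a b c
    obtain ⟨x, hx, rfl⟩ := exists_cls F a
    obtain ⟨y, hy, rfl⟩ := exists_cls F b
    obtain ⟨z, hz, rfl⟩ := exists_cls F c
    exact cls_eq F (x := x * (y + z)) (y := x * y + x * z)
      (IsFilt.mul_mem hx (add_mem hy hz))
      (add_mem (IsFilt.mul_mem hx hy) (IsFilt.mul_mem hx hz)) (by simp [mul_add])
  add_mul := by
    intro i j a b c
    obtain ⟨x, hx, rfl⟩ := exists_cls F a
    obtain ⟨y, hy, rfl⟩ := exists_cls F b
    obtain ⟨z, hz, rfl⟩ := exists_cls F c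
    exact cls_eq F (x := (x + y) * z) (y := x * z + y * z)
      (IsFilt.mul_mem (add_mem hx hy) hz)
      (add_mem (IsFilt.mul_mem hx hz) (IsFilt.mul_mem hy hz)) (by simp [add_mul])
  one_mul := by
    rintro ⟨i, a⟩
    obtain ⟨x, hx, rfl⟩ := exists_cls F a
    exact mk_cls_eq F _ _ (zero_add i) (one_mul x)
  mul_one := by
    rintro ⟨i, a⟩
    obtain ⟨x, hx, rfl⟩ := exists_cls F a
    exact mk_cls_eq F _ _ (add_zero i) (mul_one x)
  mul_assoc := by
    rintro ⟨i, a⟩ ⟨j, b⟩ ⟨l, c⟩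
    obtain ⟨x, hx, rfl⟩ := exists_cls F a
    obtain ⟨y, hy, rfl⟩ := exists_cls F b
    obtain ⟨z, hz, rfl⟩ := exists_cls F c
    exact mk_cls_eq F _ _ (add_assoc i j l) (mul_assoc x y z)
  natCast n := n • cls F 1 IsFilt.one_mem
  natCast_zero := zero_smul _ _
  natCast_succ n := by rw [add_smul, one_smul]; rfl
  intCast n := n • cls F 1 IsFilt.one_mem
  intCast_ofNat n := by simp
  intCast_negSucc_ofNat n := by rw [negSucc_zsmul]

instance gAlgebra : DirectSum.GAlgebra k (Piece F) where
  toFun :=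
    { toFun := fun c => cls F (algebraMap k R c) (algebraMap_mem F c)
      map_zero' := cls_eq F _ (zero_mem _) (by simp)
      map_add' := fun c d => cls_eq F _
        (add_mem (algebraMap_mem F c) (algebraMap_mem F d)) (by simp) }
  map_one := cls_eq F _ IsFilt.one_mem (by simp)
  map_mul c d := mk_cls_eq F _ _ rfl (map_mul _ c d)
  commutes := by
    rintro c ⟨i, a⟩
    obtain ⟨x, hx, rfl⟩ := exists_cls F a
    exact mk_cls_eq F _ _ (Nat.add_comm 0 i) (Algebra.commutes c x)
  smul_def := by
    rintro c ⟨i, a⟩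
    obtain ⟨x, hx, rfl⟩ := exists_cls F a
    exact mk_cls_eq F ((F i).smul_mem c hx) _ (zero_add i).symm (Algebra.smul_def c x)

/-- The element of degree `i` of the associated graded algebra given by `x ∈ F i`. -/
def symb (i : ℕ) (x : R) (hx : x ∈ F i) : Gr F :=
  DirectSum.of (Piece F) i (cls F x hx)

end FilteredAlgebra

/-! ### The Poisson enveloping algebra of a Poisson order -/

section Enveloping

variable (k Z A : Type*) [Field k] [CommRing Z] [Algebra k Z] [PoissonAlgebra k Z]
  [Ring A] [Algebra k A] [Algebra Z A] [IsScalarTower k Z A] [PoissonOrder k Z A]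

/-- The defining relations of the enveloping algebra, between the free generators `α a`
(`a ∈ A`) and `δ z` (`z ∈ Z`): `α` is a homomorphism of unital `k`-algebras, `δ` is a homomorphism
of Lie algebras over `k`, `α {x, a} = [δ x, α a]`, and `δ (x y) = α x δ y + α y δ x`. -/
inductive PoissonEnv.Rel : FreeAlgebra k (A ⊕ Z) → FreeAlgebra k (A ⊕ Z) → Prop
  | alpha_add (a b : A) : Rel (FreeAlgebra.ι k (.inl (a + b)))
      (FreeAlgebra.ι k (.inl a) + FreeAlgebra.ι k (.inl b))
  | alpha_smul (c : k) (a : A) : Rel (FreeAlgebra.ι k (.inl (c • a)))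
      (c • FreeAlgebra.ι k (.inl a))
  | alpha_one : Rel (FreeAlgebra.ι k (.inl 1)) 1
  | alpha_mul (a b : A) : Rel (FreeAlgebra.ι k (.inl (a * b)))
      (FreeAlgebra.ι k (.inl a) * FreeAlgebra.ι k (.inl b))
  | delta_add (x y : Z) : Rel (FreeAlgebra.ι k (.inr (x + y)))
      (FreeAlgebra.ι k (.inr x) + FreeAlgebra.ι k (.inr y))
  | delta_smul (c : k) (x : Z) : Rel (FreeAlgebra.ι k (.inr (c • x)))
      (c • FreeAlgebra.ι k (.inr x))
  | delta_bracket (x y : Z) : Rel (FreeAlgebra.ι k (.inr (PoissonAlgebra.bracket (k := k) x y)))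
      (FreeAlgebra.ι k (.inr x) * FreeAlgebra.ι k (.inr y)
        - FreeAlgebra.ι k (.inr y) * FreeAlgebra.ι k (.inr x))
  | alpha_ham (x : Z) (a : A) : Rel (FreeAlgebra.ι k (.inl (PoissonOrder.ham (k := k) x a)))
      (FreeAlgebra.ι k (.inr x) * FreeAlgebra.ι k (.inl a)
        - FreeAlgebra.ι k (.inl a) * FreeAlgebra.ι k (.inr x))
  | delta_mul (x y : Z) : Rel (FreeAlgebra.ι k (.inr (x * y)))
      (FreeAlgebra.ι k (.inl (algebraMap Z A x)) * FreeAlgebra.ι k (.inr y)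
        + FreeAlgebra.ι k (.inl (algebraMap Z A y)) * FreeAlgebra.ι k (.inr x))

/-- The Poisson enveloping algebra `Aᵉ` of the Poisson order `A` over `Z`. -/
def PoissonEnv : Type _ := RingQuot (PoissonEnv.Rel k Z A)

namespace PoissonEnv

instance : Ring (PoissonEnv k Z A) := inferInstanceAs (Ring (RingQuot (Rel k Z A)))

instance : Algebra k (PoissonEnv k Z A) := inferInstanceAs (Algebra k (RingQuot (Rel k Z A)))

/-- The quotient map from the free algebra. -/
def mk : FreeAlgebra k (A ⊕ Z) →ₐ[k] PoissonEnv k Z A := RingQuot.mkAlgHom k (Rel k Z A)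

variable {k Z A} in
theorem mk_rel {u v : FreeAlgebra k (A ⊕ Z)} (h : Rel k Z A u v) : mk k Z A u = mk k Z A v :=
  RingQuot.mkAlgHom_rel k h

/-- The generators of the enveloping algebra. -/
def gen (s : A ⊕ Z) : PoissonEnv k Z A := mk k Z A (FreeAlgebra.ι k s)

/-- The structure map `α : A → Aᵉ`. -/
def alpha : A →ₐ[k] PoissonEnv k Z A :=
  AlgHom.ofLinearMap
    { toFun := fun a => gen k Z A (.inl a)
      map_add' := fun a b => (mk_rel (.alpha_add a b)).trans (map_add _ _ _)
      map_smul' := fun c a => (mk_rel (.alpha_smul c a)).trans (map_smul _ _ _) }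
    ((mk_rel .alpha_one).trans (map_one _))
    (fun a b => (mk_rel (.alpha_mul a b)).trans (map_mul _ _ _))

/-- The structure map `δ : Z → Aᵉ`. -/
def delta : Z →ₗ[k] PoissonEnv k Z A where
  toFun := fun z => gen k Z A (.inr z)
  map_add' := fun x y => (mk_rel (.delta_add x y)).trans (map_add _ _ _)
  map_smul' := fun c x => (mk_rel (.delta_smul c x)).trans (map_smul _ _ _)

theorem delta_bracket (x y : Z) :
    delta k Z A (PoissonAlgebra.bracket (k := k) x y) =
      delta k Z A x * delta k Z A y - delta k Z A y * delta k Z A x :=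
  (mk_rel (.delta_bracket x y)).trans
    ((map_sub _ _ _).trans (congrArg₂ _ (map_mul _ _ _) (map_mul _ _ _)))

theorem alpha_ham (x : Z) (a : A) :
    alpha k Z A (PoissonOrder.ham (k := k) x a) =
      delta k Z A x * alpha k Z A a - alpha k Z A a * delta k Z A x :=
  (mk_rel (.alpha_ham x a)).trans
    ((map_sub _ _ _).trans (congrArg₂ _ (map_mul _ _ _) (map_mul _ _ _)))

theorem delta_mul (x y : Z) :
    delta k Z A (x * y) =
      alpha k Z A (algebraMap Z A x) * delta k Z A y
        + alpha k Z A (algebraMap Z A y) * delta k Z A x :=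
  (mk_rel (.delta_mul x y)).trans
    ((map_add _ _ _).trans (congrArg₂ _ (map_mul _ _ _) (map_mul _ _ _)))

/-- The PBW filtration: `F n` is spanned by the products of generators in which at most `n`
factors are of the form `δ z`. -/
def filt (n : ℕ) : Submodule k (PoissonEnv k Z A) :=
  Submodule.span k {w | ∃ l : List (A ⊕ Z), l.countP Sum.isRight ≤ n ∧
    w = (l.map (gen k Z A)).prod}

instance : FilteredAlgebra.IsFilt (filt k Z A) where
  mono m n h := Submodule.span_mono fun _ ⟨l, hl, e⟩ => ⟨l, hl.trans h, e⟩
  one_mem := Submodule.subset_span ⟨[], by simp, by simp⟩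
  mul_mem {i j x y} hx hy := by
    have h := Submodule.mul_mem_mul hx hy
    rw [filt, filt, Submodule.span_mul_span] at h
    refine Submodule.span_mono ?_ h
    rintro _ ⟨_, ⟨l, hl, rfl⟩, _, ⟨l', hl', rfl⟩, rfl⟩
    exact ⟨l ++ l', by rw [List.countP_append]; omega, by simp⟩

theorem alpha_mem (a : A) : alpha k Z A a ∈ filt k Z A 0 :=
  Submodule.subset_span ⟨[.inl a], by simp, by
    rw [List.map_singleton, List.prod_singleton]; rfl⟩

theorem delta_mem (z : Z) : delta k Z A z ∈ filt k Z A 1 :=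
  Submodule.subset_span ⟨[.inr z], by simp, by
    rw [List.map_singleton, List.prod_singleton]; rfl⟩

/-- The natural homomorphism `Zᵉ → Aᵉ` with `α z ↦ α z` and `δ z ↦ δ z`. -/
def ofBase : PoissonEnv k Z Z →ₐ[k] PoissonEnv k Z A :=
  RingQuot.liftAlgHom k ⟨FreeAlgebra.lift k
    (Sum.elim (fun z => alpha k Z A (algebraMap Z A z)) (delta k Z A)), by
    intro u v h
    cases h with
    | alpha_add a b => simp
    | alpha_smul c a =>
      have e : algebraMap Z A (c • a) = c • algebraMap Z A a :=
        (IsScalarTower.toAlgHom k Z A).toLinearMap.map_smul c a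
      simp [e]
    | alpha_one => simp
    | alpha_mul a b => simp
    | delta_add x y => simp
    | delta_smul c x => simp
    | delta_bracket x y => simpa using delta_bracket k Z A x y
    | alpha_ham x a =>
      have h := alpha_ham k Z A x (algebraMap Z A a)
      rw [PoissonOrder.ham_algebraMap] at h
      simpa [PoissonOrder.ham_self] using h
    | delta_mul x y => simpa using delta_mul k Z A x y⟩

theorem ofBase_alpha (z : Z) :
    ofBase k Z A (alpha k Z Z z) = alpha k Z A (algebraMap Z A z) := by
  refine (RingQuot.liftAlgHom_mkAlgHom_apply ..).trans ?_
  rw [FreeAlgebra.lift_ι_apply]; rfl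

theorem ofBase_delta (z : Z) : ofBase k Z A (delta k Z Z z) = delta k Z A z := by
  refine (RingQuot.liftAlgHom_mkAlgHom_apply ..).trans ?_
  rw [FreeAlgebra.lift_ι_apply]; rfl

/-- The left `Z`-module structure of `Zᵉ`: `z • u = α z * u`. -/
instance : Module Z (PoissonEnv k Z Z) := Module.compHom _ (alpha k Z Z).toRingHom

theorem smul_def (z : Z) (u : PoissonEnv k Z Z) : z • u = alpha k Z Z z * u := rfl

instance : IsScalarTower Z (PoissonEnv k Z Z) (PoissonEnv k Z Z) where
  smul_assoc z u v := mul_assoc (alpha k Z Z z) u v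

end PoissonEnv

/-- The algebra `Zᵉ` regarded as a right `Z`-module and a left module over itself. -/
def PoissonEnvRight (k Z : Type*) [Field k] [CommRing Z] [Algebra k Z] [PoissonAlgebra k Z] :
    Type _ := PoissonEnv k Z Z

namespace PoissonEnvRight

/-- The identity map from `Zᵉ`. -/
def of : PoissonEnv k Z Z ≃ PoissonEnvRight k Z := Equiv.refl _

instance : AddCommGroup (PoissonEnvRight k Z) :=
  inferInstanceAs (AddCommGroup (PoissonEnv k Z Z))

instance : Module (PoissonEnv k Z Z) (PoissonEnvRight k Z) :=
  inferInstanceAs (Module (PoissonEnv k Z Z) (PoissonEnv k Z Z))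

/-- The right action of the commutative algebra `Z`: `z` sends `u` to `u * α z`. -/
instance : Module Z (PoissonEnvRight k Z) where
  smul z u := of k Z ((of k Z).symm u * PoissonEnv.alpha k Z Z z)
  one_smul u := by
    change (of k Z).symm u * PoissonEnv.alpha k Z Z 1 = (of k Z).symm u
    rw [map_one, mul_one]
  mul_smul x y u := by
    change (of k Z).symm u * PoissonEnv.alpha k Z Z (x * y)
      = (of k Z).symm u * PoissonEnv.alpha k Z Z y * PoissonEnv.alpha k Z Z x
    rw [mul_comm x y, map_mul, mul_assoc]
  smul_zero z := zero_mul (PoissonEnv.alpha k Z Z z)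
  smul_add z u v := add_mul ((of k Z).symm u) ((of k Z).symm v) (PoissonEnv.alpha k Z Z z)
  add_smul x y u := by
    change (of k Z).symm u * PoissonEnv.alpha k Z Z (x + y)
      = (of k Z).symm u * PoissonEnv.alpha k Z Z x + (of k Z).symm u * PoissonEnv.alpha k Z Z y
    rw [map_add, mul_add]
  zero_smul u := by
    change (of k Z).symm u * PoissonEnv.alpha k Z Z 0 = (0 : PoissonEnv k Z Z)
    rw [map_zero, mul_zero]

theorem smul_def (z : Z) (u : PoissonEnv k Z Z) :
    z • of k Z u = of k Z (u * PoissonEnv.alpha k Z Z z) := rfl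

instance : SMulCommClass Z (PoissonEnv k Z Z) (PoissonEnvRight k Z) where
  smul_comm z u v := mul_assoc u ((of k Z).symm v) (PoissonEnv.alpha k Z Z z)

end PoissonEnvRight

/-- A `k`-algebra homomorphism `A ⊗_Z S_Z(Ω) → gr Aᵉ` is the natural one if it sends `a ⊗ 1` to
the class of `α a` in degree `0` and `1 ⊗ dz` to the class of `δ z` in degree `1`. -/
def PoissonEnv.IsNatural
    (φ : A ⊗[Z] SymmetricAlgebra Z (Ω[Z⁄k]) →ₐ[k] FilteredAlgebra.Gr (PoissonEnv.filt k Z A)) :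
    Prop :=
  (∀ a : A, φ (a ⊗ₜ 1) =
    FilteredAlgebra.symb (filt k Z A) 0 (alpha k Z A a) (alpha_mem k Z A a)) ∧
  (∀ z : Z, φ (1 ⊗ₜ SymmetricAlgebra.ι Z (Ω[Z⁄k]) (KaehlerDifferential.D k Z z)) =
    FilteredAlgebra.symb (filt k Z A) 1 (delta k Z A z) (delta_mem k Z A z))

end Enveloping

/-! All three statements come from letting `Aᵉ` act on the module expected to describe it and
looking at the orbit of `1 ⊗ 1`. If `N` is a `Z`-module with operators for `δ x` obeying the
relations of `Zᵉ` (a `HamiltonianAction`), then `A ⊗_Z N` is an `Aᵉ`-module, where `δ x` sends `a ⊗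
n` to `{x, a} ⊗ n + a ⊗ x n`. The relation `δ {x, y} = [δ x, δ y]` holds there because `A` is a
Poisson module over itself.

With `N = Zᵉ`, the orbit map `w ↦ w (1 ⊗ 1)` is inverse to `a ⊗ u ↦ α a * ι u`. A mirrored right
action gives the other isomorphism. Neither argument uses regularity.

For the graded statement, the natural map exists and is onto because commutators of generators drop
the filtration degree and the classes of `α a` and `δ z` generate the graded algebra. Injectivity
needs a Hamiltonian action on `N = S(Ω)` in which `x` acts as multiplication by `dx` up to terms
that do not raise the degree. The top component of `w (1 ⊗ 1)` then recovers the element of `A ⊗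
S(Ω)` from its image (`IsNatural.injective`).

Such an action is a flat connection, and it exists when `Ω` is finite projective
(`exists_hamiltonianAction`). A splitting of `Zʳ → Ω` realises `S(Ω)` as the fixed points of an
idempotent endomorphism of `Z[X₁, …, Xᵣ]`. The operators `dx * p + ∇ₓ p` satisfy every relation
except the one for brackets. Their curvature is removed one polynomial degree at a time: the Bianchi
identity says that its leading part is a Koszul cocycle, which is a coboundary
(`exists_koszul_primitive`), and a primitive of it is the correction (`exists_flatBelow_succ`).

Projectivity of `Ω` is the Jacobian side of regularity. At a maximal ideal the residue field is `k`,
so the differentials of a minimal set of generators of the maximal ideal span `Ω`. Their number is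
the dimension, which is at most the dimension of the differentials of the fraction field, so they
are independent. -/

namespace PoissonEnv

/-! ### Universal property and induction on generators -/

section Lift

variable {k Z A : Type*} [Field k] [CommRing Z] [Algebra k Z] [PoissonAlgebra k Z]
  [Ring A] [Algebra k A] [Algebra Z A] [IsScalarTower k Z A] [PoissonOrder k Z A]
  {B : Type*} [Ring B] [Algebra k B]

/-- The universal property of the enveloping algebra. -/
def lift (f : A →ₐ[k] B) (g : Z →ₗ[k] B)
    (hlie : ∀ x y, g (PoissonAlgebra.bracket (k := k) x y) = g x * g y - g y * g x)
    (hham : ∀ x a, f (PoissonOrder.ham (k := k) x a) = g x * f a - f a * g x)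
    (hmul : ∀ x y, g (x * y) = f (algebraMap Z A x) * g y + f (algebraMap Z A y) * g x) :
    PoissonEnv k Z A →ₐ[k] B :=
  RingQuot.liftAlgHom k ⟨FreeAlgebra.lift k (Sum.elim f g), by
    intro u v h
    cases h with
    | alpha_add a b => simp
    | alpha_smul c a => simp
    | alpha_one => simp
    | alpha_mul a b => simp
    | delta_add x y => simp
    | delta_smul c x => simp
    | delta_bracket x y => simpa using hlie x y
    | alpha_ham x a => simpa using hham x a
    | delta_mul x y => simpa using hmul x y⟩

section

variable (f : A →ₐ[k] B) (g : Z →ₗ[k] B)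
    (hlie : ∀ x y, g (PoissonAlgebra.bracket (k := k) x y) = g x * g y - g y * g x)
    (hham : ∀ x a, f (PoissonOrder.ham (k := k) x a) = g x * f a - f a * g x)
    (hmul : ∀ x y, g (x * y) = f (algebraMap Z A x) * g y + f (algebraMap Z A y) * g x)

@[simp]
theorem lift_alpha (a : A) : lift f g hlie hham hmul (alpha k Z A a) = f a := by
  refine (RingQuot.liftAlgHom_mkAlgHom_apply ..).trans ?_
  rw [FreeAlgebra.lift_ι_apply]; rfl

@[simp]
theorem lift_delta (z : Z) : lift f g hlie hham hmul (delta k Z A z) = g z := by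
  refine (RingQuot.liftAlgHom_mkAlgHom_apply ..).trans ?_
  rw [FreeAlgebra.lift_ι_apply]; rfl

end

theorem gen_inl (a : A) : gen k Z A (.inl a) = alpha k Z A a := rfl

theorem gen_inr (z : Z) : gen k Z A (.inr z) = delta k Z A z := rfl

-- `Aᵉ` is generated by `1` under sums, scalars and left multiplication by generators. This is the
-- form suited to orbit maps of a left module; `gen_induction_right` serves right modules.
@[elab_as_elim]
theorem gen_induction {p : PoissonEnv k Z A → Prop} (one : p 1)
    (add : ∀ u v, p u → p v → p (u + v)) (smul : ∀ (c : k) u, p u → p (c • u))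
    (alpha_mul : ∀ a u, p u → p (alpha k Z A a * u))
    (delta_mul : ∀ z u, p u → p (delta k Z A z * u)) (u : PoissonEnv k Z A) : p u := by
  obtain ⟨w, rfl⟩ : ∃ w, mk k Z A w = u := RingQuot.mkAlgHom_surjective k _ u
  suffices h : ∀ u, p u → p (mk k Z A w * u) by simpa using h 1 one
  induction w using FreeAlgebra.induction with
  | grade0 r =>
    intro u hu
    rw [AlgHom.commutes, ← Algebra.smul_def]
    exact smul r u hu
  | grade1 s =>
    rcases s with a | z
    · exact fun u hu => alpha_mul a u hu
    · exact fun u hu => delta_mul z u hu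
  | mul a b ha hb =>
    intro u hu
    rw [map_mul, mul_assoc]
    exact ha _ (hb u hu)
  | add a b ha hb =>
    intro u hu
    rw [map_add, add_mul]
    exact add _ _ (ha u hu) (hb u hu)

@[elab_as_elim]
theorem gen_induction_right {p : PoissonEnv k Z A → Prop} (one : p 1)
    (add : ∀ u v, p u → p v → p (u + v)) (smul : ∀ (c : k) u, p u → p (c • u))
    (mul_alpha : ∀ a u, p u → p (u * alpha k Z A a))
    (mul_delta : ∀ z u, p u → p (u * delta k Z A z)) (u : PoissonEnv k Z A) : p u := by
  obtain ⟨w, rfl⟩ : ∃ w, mk k Z A w = u := RingQuot.mkAlgHom_surjective k _ u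
  suffices h : ∀ u, p u → p (u * mk k Z A w) by simpa using h 1 one
  induction w using FreeAlgebra.induction with
  | grade0 r =>
    intro u hu
    rw [AlgHom.commutes, ← Algebra.commutes, ← Algebra.smul_def]
    exact smul r u hu
  | grade1 s =>
    rcases s with a | z
    · exact fun u hu => mul_alpha a u hu
    · exact fun u hu => mul_delta z u hu
  | mul a b ha hb =>
    intro u hu
    rw [map_mul, ← mul_assoc]
    exact hb _ (ha u hu)
  | add a b ha hb =>
    intro u hu
    rw [map_add, mul_add]
    exact add _ _ (ha u hu) (hb u hu)

theorem delta_mul_alpha (x : Z) (a : A) :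
    delta k Z A x * alpha k Z A a =
      alpha k Z A a * delta k Z A x + alpha k Z A (PoissonOrder.ham (k := k) x a) := by
  rw [alpha_ham]; abel

theorem ham_one (x : Z) : PoissonOrder.ham (k := k) x (1 : A) = 0 := by
  have h := PoissonOrder.ham_mul (k := k) x (1 : A) 1
  rw [mul_one, mul_one, one_mul] at h
  exact left_eq_add.mp h

theorem ham_smul (x y : Z) (a : A) : PoissonOrder.ham (k := k) x (y • a) =
    PoissonAlgebra.bracket (k := k) x y • a + y • PoissonOrder.ham (k := k) x a := by
  rw [Algebra.smul_def, PoissonOrder.ham_mul, PoissonOrder.ham_algebraMap, Algebra.smul_def,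
    Algebra.smul_def]

end Lift

end PoissonEnv

/-! ### Hamiltonian actions and the induced representation on `A ⊗ N` -/

namespace PoissonAlgebra

variable {k Z : Type*} [Field k] [CommRing Z] [Algebra k Z] [PoissonAlgebra k Z]

theorem bracket_skew (x y : Z) : bracket (k := k) x y = - bracket (k := k) y x := by
  have h := bracket_self (k := k) (x + y)
  simp only [map_add, LinearMap.add_apply, bracket_self, zero_add, add_zero] at h
  exact eq_neg_of_add_eq_zero_right h

theorem mul_bracket (x y z : Z) :
    bracket (k := k) (x * y) z = x * bracket (k := k) y z + y * bracket (k := k) x z :=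
  PoissonOrder.mul_ham (k := k) (A := Z) x y z

theorem bracket_bracket (x y z : Z) : bracket (k := k) (bracket (k := k) x y) z =
    bracket (k := k) x (bracket (k := k) y z) - bracket (k := k) y (bracket (k := k) x z) := by
  have h := jacobi (k := k) x y z
  rw [bracket_skew z (bracket (k := k) x y), bracket_skew z x, map_neg] at h
  linear_combination -h

end PoissonAlgebra

/-- A representation of the Poisson algebra `Z` on a `Z`-module, as a Lie algebra acting by
Hamiltonian operators: this is the same as an action of the enveloping algebra of `Z`. -/
structure HamiltonianAction (k Z N : Type*) [Field k] [CommRing Z] [Algebra k Z]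
    [PoissonAlgebra k Z] [AddCommGroup N] [Module k N] [Module Z N] where
  /-- The operators. -/
  op : Z →ₗ[k] Module.End k N
  op_smul : ∀ (x c : Z) (n : N),
    op x (c • n) = c • op x n + PoissonAlgebra.bracket (k := k) x c • n
  op_mul : ∀ (x y : Z) (n : N), op (x * y) n = x • op y n + y • op x n
  op_bracket : ∀ (x y : Z) (n : N),
    op (PoissonAlgebra.bracket (k := k) x y) n = op x (op y n) - op y (op x n)

namespace HamiltonianAction

variable {k Z N : Type*} [Field k] [CommRing Z] [Algebra k Z]
    [PoissonAlgebra k Z] [AddCommGroup N] [Module k N] [Module Z N] [IsScalarTower k Z N]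
    (e : HamiltonianAction k Z N)
    (A : Type*) [Ring A] [Algebra k A] [Algebra Z A] [IsScalarTower k Z A] [PoissonOrder k Z A]

/-- The operator `a ⊗ n ↦ {x, a} ⊗ n + a ⊗ x n` on `A ⊗ N`. -/
def tensorOpAux (x : Z) : A ⊗[Z] N →+ A ⊗[Z] N :=
  TensorProduct.liftAddHom
    { toFun := fun a =>
        { toFun := fun n => PoissonOrder.ham (k := k) x a ⊗ₜ n + a ⊗ₜ e.op x n
          map_zero' := by simp
          map_add' := fun n m => by simp only [map_add, TensorProduct.tmul_add]; abel }
      map_zero' := by ext; simp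
      map_add' := fun a b => by
        ext; simp only [map_add, TensorProduct.add_tmul, AddMonoidHom.coe_mk, ZeroHom.coe_mk,
          AddMonoidHom.add_apply]; abel }
    -- Neither summand is balanced over `Z` by itself: each produces a term with `{x, r}`, and these
    -- two terms agree in the tensor product.
    (fun r a n => by
      simp only [AddMonoidHom.coe_mk, ZeroHom.coe_mk, PoissonEnv.ham_smul, e.op_smul,
        TensorProduct.add_tmul, TensorProduct.tmul_add, TensorProduct.smul_tmul]
      abel)

/-- The operator `a ⊗ n ↦ {x, a} ⊗ n + a ⊗ x n` on `A ⊗ N`. -/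
def tensorOp : Z →ₗ[k] Module.End k (A ⊗[Z] N) where
  toFun x :=
    { toFun := e.tensorOpAux A x
      map_add' := map_add _
      map_smul' := fun c t => by
        induction t with
        | zero => simp
        | tmul a n =>
          simp only [TensorProduct.smul_tmul', tensorOpAux, TensorProduct.liftAddHom_tmul,
            AddMonoidHom.coe_mk, ZeroHom.coe_mk, map_smul, RingHom.id_apply, smul_add]
        | add s t hs ht => rw [smul_add, map_add, hs, ht, map_add, smul_add] }
  map_add' x y := by
    refine LinearMap.ext fun t => ?_
    induction t with
    | zero => simp
    | tmul a n =>
      simp only [tensorOpAux, LinearMap.coe_mk, AddHom.coe_mk, TensorProduct.liftAddHom_tmul,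
            AddMonoidHom.coe_mk, ZeroHom.coe_mk, map_add, LinearMap.add_apply,
            TensorProduct.add_tmul, TensorProduct.tmul_add]
      abel
    | add s t hs ht => rw [map_add, hs, ht, map_add]
  map_smul' c x := by
    refine LinearMap.ext fun t => ?_
    induction t with
    | zero => simp
    | tmul a n =>
      have h : a ⊗ₜ[Z] (c • e.op x n) = c • (a ⊗ₜ[Z] e.op x n) := by
        rw [← algebraMap_smul Z c (e.op x n), TensorProduct.tmul_smul, TensorProduct.smul_tmul',
          TensorProduct.smul_tmul', algebraMap_smul]
      simp only [tensorOpAux, LinearMap.coe_mk, AddHom.coe_mk, TensorProduct.liftAddHom_tmul,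
            AddMonoidHom.coe_mk, ZeroHom.coe_mk, map_smul, LinearMap.smul_apply,
            TensorProduct.smul_tmul', RingHom.id_apply, smul_add, h]
    | add s t hs ht => rw [map_add, hs, ht, map_add]

variable {A} in
@[simp]
theorem tensorOp_tmul (x : Z) (a : A) (n : N) :
    e.tensorOp A x (a ⊗ₜ n) = PoissonOrder.ham (k := k) x a ⊗ₜ n + a ⊗ₜ e.op x n := rfl

/-- A Hamiltonian action on `N` induces a representation of the enveloping algebra of `A`
on `A ⊗ N`. -/
def rep (hLie : ∀ (x y : Z) (a : A),
      PoissonOrder.ham (k := k) (PoissonAlgebra.bracket (k := k) x y) a =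
        PoissonOrder.ham (k := k) x (PoissonOrder.ham (k := k) y a)
          - PoissonOrder.ham (k := k) y (PoissonOrder.ham (k := k) x a)) :
    PoissonEnv k Z A →ₐ[k] Module.End k (A ⊗[Z] N) :=
  PoissonEnv.lift (B := Module.End k (A ⊗[Z] N))
    (Algebra.lsmul k k (A ⊗[Z] N) : A →ₐ[k] Module.End k (A ⊗[Z] N)) (e.tensorOp A)
    (fun x y => by
      refine LinearMap.ext fun t => ?_
      induction t with
      | zero => simp
      | add s t hs ht => rw [map_add, hs, ht, map_add]
      | tmul a n =>
        simp only [tensorOp_tmul, LinearMap.sub_apply, Module.End.mul_apply, map_add, hLie,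
          e.op_bracket, TensorProduct.sub_tmul, TensorProduct.tmul_sub]
        abel)
    (fun x a => by
      refine LinearMap.ext fun t => ?_
      induction t with
      | zero => simp
      | add s t hs ht => rw [map_add, hs, ht, map_add]
      | tmul b n =>
        simp only [tensorOp_tmul, LinearMap.sub_apply, Module.End.mul_apply, map_add,
          Algebra.lsmul_coe, TensorProduct.smul_tmul', smul_eq_mul, PoissonOrder.ham_mul,
          TensorProduct.add_tmul]
        abel)
    (fun x y => by
      refine LinearMap.ext fun t => ?_
      induction t with
      | zero => simp
      | add s t hs ht => rw [map_add, hs, ht, map_add]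
      | tmul b n =>
        simp only [tensorOp_tmul, LinearMap.add_apply, Module.End.mul_apply,
          Algebra.lsmul_coe, TensorProduct.smul_tmul', PoissonOrder.mul_ham, e.op_mul,
          TensorProduct.add_tmul, smul_add, TensorProduct.tmul_add, algebraMap_smul,
          TensorProduct.tmul_smul]
        abel)

section

variable (hLie : ∀ (x y : Z) (a : A),
      PoissonOrder.ham (k := k) (PoissonAlgebra.bracket (k := k) x y) a =
        PoissonOrder.ham (k := k) x (PoissonOrder.ham (k := k) y a)
          - PoissonOrder.ham (k := k) y (PoissonOrder.ham (k := k) x a))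

@[simp]
theorem rep_alpha (a : A) (t : A ⊗[Z] N) : e.rep A hLie (PoissonEnv.alpha k Z A a) t = a • t := by
  rw [rep, PoissonEnv.lift_alpha]; rfl

@[simp]
theorem rep_delta (x : Z) : e.rep A hLie (PoissonEnv.delta k Z A x) = e.tensorOp A x := by
  rw [rep, PoissonEnv.lift_delta]

end

end HamiltonianAction

/-! ### The isomorphism `A ⊗ Zᵉ → Aᵉ` -/

namespace PoissonEnv

variable {k Z : Type*} [Field k] [CommRing Z] [Algebra k Z] [PoissonAlgebra k Z]

instance : IsScalarTower k Z (PoissonEnv k Z Z) where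
  smul_assoc c z u := by
    rw [smul_def, smul_def, map_smul, smul_mul_assoc]

variable (k Z) in
/-- The enveloping algebra of `Z` acting on itself by left multiplication. -/
def leftAction : HamiltonianAction k Z (PoissonEnv k Z Z) where
  op := (LinearMap.mul k _).comp (delta k Z Z)
  op_smul x c n := by
    simp only [LinearMap.comp_apply, LinearMap.mul_apply_apply, smul_def]
    rw [← mul_assoc, delta_mul_alpha, add_mul, mul_assoc, PoissonOrder.ham_self]
  op_mul x y n := by
    simp only [LinearMap.comp_apply, LinearMap.mul_apply_apply, smul_def, delta_mul, add_mul,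
      mul_assoc, Algebra.algebraMap_self, RingHom.id_apply]
  op_bracket x y n := by
    simp only [LinearMap.comp_apply, LinearMap.mul_apply_apply, delta_bracket, sub_mul, mul_assoc]

theorem leftAction_op (x : Z) (u : PoissonEnv k Z Z) :
    (leftAction k Z).op x u = delta k Z Z x * u := rfl

variable {A : Type*} [Ring A] [Algebra k A] [Algebra Z A] [IsScalarTower k Z A]
  [PoissonOrder k Z A]

variable (k Z A) in
/-- The map `A ⊗ Zᵉ → Aᵉ`, `a ⊗ u ↦ α a * u`. -/
def ofTensor : A ⊗[Z] PoissonEnv k Z Z →+ PoissonEnv k Z A :=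
  TensorProduct.liftAddHom
    ((AddMonoidHom.mul.compr₂ (AddMonoidHom.id _)).compl₂
      (ofBase k Z A : PoissonEnv k Z Z →+ PoissonEnv k Z A) |>.comp
      (alpha k Z A : A →+ PoissonEnv k Z A))
    (fun z a u => by
      change alpha k Z A (z • a) * ofBase k Z A u = alpha k Z A a * ofBase k Z A (z • u)
      rw [smul_def, map_mul, ofBase_alpha, Algebra.smul_def, Algebra.commutes, map_mul,
        mul_assoc])

@[simp]
theorem ofTensor_tmul (a : A) (u : PoissonEnv k Z Z) :
    ofTensor k Z A (a ⊗ₜ u) = alpha k Z A a * ofBase k Z A u := rfl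

theorem ofTensor_smul (a : A) (t : A ⊗[Z] PoissonEnv k Z Z) :
    ofTensor k Z A (a • t) = alpha k Z A a * ofTensor k Z A t := by
  induction t with
  | zero => simp
  | tmul b u => simp [TensorProduct.smul_tmul', mul_assoc]
  | add s t hs ht => rw [smul_add, map_add, hs, ht, map_add, mul_add]

/-- This is the commutation rule `δ x * α b = α b * δ x + α {x, b}`. Together with `ofTensor_smul`
it makes `ofTensor` linear over `Aᵉ`. -/
theorem ofTensor_tensorOp (x : Z) (t : A ⊗[Z] PoissonEnv k Z Z) :
    ofTensor k Z A ((leftAction k Z).tensorOp A x t) = delta k Z A x * ofTensor k Z A t := by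
  induction t with
  | zero => simp
  | tmul b u =>
    rw [HamiltonianAction.tensorOp_tmul, map_add, ofTensor_tmul, ofTensor_tmul, leftAction_op,
      map_mul, ofBase_delta, ofTensor_tmul, ← mul_assoc, ← mul_assoc, delta_mul_alpha, ← add_mul,
      add_comm]
  | add s t hs ht => rw [map_add, map_add, hs, ht, map_add, mul_add]

theorem ofTensor_mulRight (t : A ⊗[Z] PoissonEnv k Z Z) (u : PoissonEnv k Z Z) :
    ofTensor k Z A (LinearMap.lTensor A (LinearMap.mulRight Z u) t) =
      ofTensor k Z A t * ofBase k Z A u := by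
  induction t with
  | zero => simp
  | tmul b v => simp [mul_assoc]
  | add s t hs ht => rw [map_add, map_add, hs, ht, map_add, add_mul]

section

variable (hLie : ∀ (x y : Z) (a : A),
      PoissonOrder.ham (k := k) (PoissonAlgebra.bracket (k := k) x y) a =
        PoissonOrder.ham (k := k) x (PoissonOrder.ham (k := k) y a)
          - PoissonOrder.ham (k := k) y (PoissonOrder.ham (k := k) x a))
include hLie

/-- The inverse is the orbit map `w ↦ w (1 ⊗ 1)`. Surjectivity follows because `ofTensor` is linear
over `Aᵉ` and sends `1 ⊗ 1` to `1`. -/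
theorem ofTensor_bijective : Function.Bijective (ofTensor k Z A) := by
  let r := (leftAction k Z).rep A hLie
  -- Since `{x, 1} = 0` in `A`, the subalgebra coming from `Zᵉ` moves only the second factor.
  have base : ∀ u : PoissonEnv k Z Z, r (ofBase k Z A u) (1 ⊗ₜ 1) = 1 ⊗ₜ u := by
    intro u
    induction u using gen_induction with
    | one => simp
    | add u v hu hv => rw [map_add, map_add, LinearMap.add_apply, hu, hv, TensorProduct.tmul_add]
    | smul c u hu =>
      rw [map_smul, map_smul, LinearMap.smul_apply, hu, ← algebraMap_smul Z c u,
        TensorProduct.tmul_smul, algebraMap_smul]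
    | alpha_mul a u hu =>
      rw [map_mul, map_mul, Module.End.mul_apply, hu, ofBase_alpha, HamiltonianAction.rep_alpha,
        algebraMap_smul, ← TensorProduct.tmul_smul, smul_def]
    | delta_mul x u hu =>
      rw [map_mul, map_mul, Module.End.mul_apply, hu, ofBase_delta, HamiltonianAction.rep_delta,
        HamiltonianAction.tensorOp_tmul, ham_one, TensorProduct.zero_tmul, zero_add, leftAction_op]
  have inv : ∀ t, r (ofTensor k Z A t) (1 ⊗ₜ 1) = t := by
    intro t
    induction t with
    | zero => simp
    | tmul a u =>
      rw [ofTensor_tmul, map_mul, Module.End.mul_apply, base, HamiltonianAction.rep_alpha,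
        TensorProduct.smul_tmul', smul_eq_mul, mul_one]
    | add s t hs ht => rw [map_add, map_add, LinearMap.add_apply, hs, ht]
  refine ⟨fun s t h => by rw [← inv s, h, inv], fun w => ⟨r w (1 ⊗ₜ 1), ?_⟩⟩
  induction w using gen_induction with
  | one => simp
  | add u v hu hv => rw [map_add, LinearMap.add_apply, map_add, hu, hv]
  | smul c u hu =>
    rw [map_smul, LinearMap.smul_apply, ← algebraMap_smul A c, ofTensor_smul, hu,
      AlgHom.commutes, Algebra.smul_def]
  | alpha_mul a u hu =>
    rw [map_mul, Module.End.mul_apply, HamiltonianAction.rep_alpha, ofTensor_smul, hu]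
  | delta_mul x u hu =>
    rw [map_mul, Module.End.mul_apply, HamiltonianAction.rep_delta, ofTensor_tensorOp, hu]

end

end PoissonEnv

/-! ### The isomorphism `Zᵉ ⊗ A → Aᵉ`, by a right action -/

namespace PoissonEnvRight

variable {k Z : Type*} [Field k] [CommRing Z] [Algebra k Z] [PoissonAlgebra k Z]
  {A : Type*} [Ring A] [Algebra k A] [Algebra Z A] [IsScalarTower k Z A] [PoissonOrder k Z A]

instance : Module k (PoissonEnvRight k Z) := inferInstanceAs (Module k (PoissonEnv k Z Z))

instance : IsScalarTower k Z (PoissonEnvRight k Z) where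
  smul_assoc c z u := by
    change (of k Z).symm u * PoissonEnv.alpha k Z Z (c • z)
      = c • ((of k Z).symm u * PoissonEnv.alpha k Z Z z)
    rw [map_smul, mul_smul_comm]

variable (k Z) in
/-- Right multiplication by `δ x` on `Zᵉ`. -/
def mulDelta : Z →ₗ[k] Module.End k (PoissonEnvRight k Z) :=
  (LinearMap.mul k (PoissonEnv k Z Z)).flip.comp (PoissonEnv.delta k Z Z)

theorem mulDelta_of (x : Z) (u : PoissonEnv k Z Z) :
    mulDelta k Z x (of k Z u) = of k Z (u * PoissonEnv.delta k Z Z x) := rfl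

/-- From `α z * δ x = δ x * α z - α {x, z}`. The sign is opposite to the one in a left action, and
this is why `{x, a}` is subtracted in `tensorOp`. -/
theorem mulDelta_smul (x z : Z) (u : PoissonEnvRight k Z) :
    mulDelta k Z x (z • u) =
      z • mulDelta k Z x u - PoissonAlgebra.bracket (k := k) x z • u := by
  change (of k Z).symm u * PoissonEnv.alpha k Z Z z * PoissonEnv.delta k Z Z x
    = (of k Z).symm u * PoissonEnv.delta k Z Z x * PoissonEnv.alpha k Z Z z
      - (of k Z).symm u * PoissonEnv.alpha k Z Z (PoissonAlgebra.bracket (k := k) x z)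
  rw [mul_assoc _ (PoissonEnv.delta k Z Z x), PoissonEnv.delta_mul_alpha, mul_add,
    PoissonOrder.ham_self, mul_assoc, add_sub_cancel_right]

theorem mulDelta_mul (x y : Z) (u : PoissonEnvRight k Z) :
    mulDelta k Z (x * y) u = mulDelta k Z y (x • u) + mulDelta k Z x (y • u) := by
  change (of k Z).symm u * PoissonEnv.delta k Z Z (x * y)
    = (of k Z).symm u * PoissonEnv.alpha k Z Z x * PoissonEnv.delta k Z Z y
      + (of k Z).symm u * PoissonEnv.alpha k Z Z y * PoissonEnv.delta k Z Z x
  rw [PoissonEnv.delta_mul, mul_add, mul_assoc, mul_assoc]; rfl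

theorem mulDelta_bracket (x y : Z) (u : PoissonEnvRight k Z) :
    mulDelta k Z (PoissonAlgebra.bracket (k := k) x y) u =
      mulDelta k Z y (mulDelta k Z x u) - mulDelta k Z x (mulDelta k Z y u) := by
  change (of k Z).symm u * PoissonEnv.delta k Z Z (PoissonAlgebra.bracket (k := k) x y)
    = (of k Z).symm u * PoissonEnv.delta k Z Z x * PoissonEnv.delta k Z Z y
      - (of k Z).symm u * PoissonEnv.delta k Z Z y * PoissonEnv.delta k Z Z x
  rw [PoissonEnv.delta_bracket, mul_sub, mul_assoc, mul_assoc]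

/-- The operator `u ⊗ a ↦ u * δ x ⊗ a - u ⊗ {x, a}` on `Zᵉ ⊗ A`. -/
def tensorOpAux (A : Type*) [Ring A] [Algebra k A] [Algebra Z A] [IsScalarTower k Z A]
    [PoissonOrder k Z A] (x : Z) : PoissonEnvRight k Z ⊗[Z] A →+ PoissonEnvRight k Z ⊗[Z] A :=
  TensorProduct.liftAddHom
    { toFun := fun u =>
        { toFun := fun a => mulDelta k Z x u ⊗ₜ a - u ⊗ₜ PoissonOrder.ham (k := k) x a
          map_zero' := by simp
          map_add' := fun n m => by simp only [map_add, TensorProduct.tmul_add]; abel }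
      map_zero' := by ext; simp
      map_add' := fun a b => by
        ext; simp only [map_add, TensorProduct.add_tmul, AddMonoidHom.coe_mk, ZeroHom.coe_mk,
          AddMonoidHom.add_apply]; abel }
    (fun r u a => by
      simp only [AddMonoidHom.coe_mk, ZeroHom.coe_mk, PoissonEnv.ham_smul, mulDelta_smul,
        TensorProduct.sub_tmul, TensorProduct.tmul_add, TensorProduct.smul_tmul]
      abel)

omit [PoissonOrder k Z A] in
theorem tmul_smul_base (c : k) (u : PoissonEnvRight k Z) (a : A) :
    u ⊗ₜ[Z] (c • a) = c • (u ⊗ₜ[Z] a) := by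
  rw [← algebraMap_smul Z c a, TensorProduct.tmul_smul, TensorProduct.smul_tmul',
    TensorProduct.smul_tmul', algebraMap_smul]

variable (A) in
/-- The operator `u ⊗ a ↦ u * δ x ⊗ a - u ⊗ {x, a}` on `Zᵉ ⊗ A`. -/
def tensorOp : Z →ₗ[k] Module.End k (PoissonEnvRight k Z ⊗[Z] A) where
  toFun x :=
    { toFun := tensorOpAux A x
      map_add' := map_add _
      map_smul' := fun c t => by
        induction t with
        | zero => simp
        | tmul u a =>
          simp only [TensorProduct.smul_tmul', tensorOpAux, TensorProduct.liftAddHom_tmul,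
            AddMonoidHom.coe_mk, ZeroHom.coe_mk, map_smul, RingHom.id_apply, smul_sub]
        | add s t hs ht => rw [smul_add, map_add, hs, ht, map_add, smul_add] }
  map_add' x y := by
    refine LinearMap.ext fun t => ?_
    induction t with
    | zero => simp
    | tmul u a =>
      simp only [tensorOpAux, LinearMap.coe_mk, AddHom.coe_mk, TensorProduct.liftAddHom_tmul,
            AddMonoidHom.coe_mk, ZeroHom.coe_mk, map_add, LinearMap.add_apply,
            TensorProduct.add_tmul, TensorProduct.tmul_add]
      abel
    | add s t hs ht => rw [map_add, hs, ht, map_add]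
  map_smul' c x := by
    refine LinearMap.ext fun t => ?_
    induction t with
    | zero => simp
    | tmul u a =>
      simp only [tensorOpAux, LinearMap.coe_mk, AddHom.coe_mk, TensorProduct.liftAddHom_tmul,
            AddMonoidHom.coe_mk, ZeroHom.coe_mk, map_smul, LinearMap.smul_apply,
            TensorProduct.smul_tmul', RingHom.id_apply, smul_sub, tmul_smul_base]
    | add s t hs ht => rw [map_add, hs, ht, map_add]

@[simp]
theorem tensorOp_tmul (x : Z) (u : PoissonEnvRight k Z) (a : A) :
    tensorOp A x (u ⊗ₜ a) = mulDelta k Z x u ⊗ₜ a - u ⊗ₜ PoissonOrder.ham (k := k) x a := rfl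

variable (A) in
/-- Right multiplication by `a` on `Zᵉ ⊗ A`. -/
def tensorMulRight : A →ₗ[k] Module.End k (PoissonEnvRight k Z ⊗[Z] A) where
  toFun a :=
    { toFun := LinearMap.lTensor (PoissonEnvRight k Z) (LinearMap.mulRight Z a)
      map_add' := map_add _
      map_smul' := fun c t => by
        induction t with
        | zero => simp
        | tmul u b =>
          simp only [TensorProduct.smul_tmul', LinearMap.lTensor_tmul, RingHom.id_apply]
        | add s t hs ht => rw [smul_add, map_add, hs, ht, map_add, smul_add] }
  map_add' a b := by
    refine LinearMap.ext fun t => ?_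
    induction t with
    | zero => rw [map_zero, map_zero]
    | tmul u c =>
      simp only [LinearMap.coe_mk, AddHom.coe_mk, LinearMap.lTensor_tmul, LinearMap.add_apply,
        LinearMap.mulRight_apply, mul_add, TensorProduct.tmul_add]
    | add s t hs ht => rw [map_add, hs, ht, map_add]
  map_smul' c a := by
    refine LinearMap.ext fun t => ?_
    induction t with
    | zero => rw [map_zero, map_zero]
    | tmul u b =>
      simp only [LinearMap.coe_mk, AddHom.coe_mk, LinearMap.lTensor_tmul, LinearMap.smul_apply,
        LinearMap.mulRight_apply, mul_smul_comm, tmul_smul_base, RingHom.id_apply]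
    | add s t hs ht => rw [map_add, hs, ht, map_add]

omit [PoissonOrder k Z A] in
theorem tensorMulRight_tmul (a b : A) (u : PoissonEnvRight k Z) :
    tensorMulRight A a (u ⊗ₜ b) = u ⊗ₜ (b * a) := rfl

variable (A) in
/-- Right multiplication of `A` on `Zᵉ ⊗ A`. -/
def tensorMul : A →ₐ[k] (Module.End k (PoissonEnvRight k Z ⊗[Z] A))ᵐᵒᵖ :=
  AlgHom.ofLinearMap ((MulOpposite.opLinearEquiv k).toLinearMap.comp (tensorMulRight A))
    (by
      refine MulOpposite.unop_injective (LinearMap.ext fun t => ?_)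
      change tensorMulRight A 1 t = t
      induction t with
      | zero => rw [map_zero]
      | tmul u b => rw [tensorMulRight_tmul, mul_one]
      | add s t hs ht => rw [map_add, hs, ht])
    (fun a b => by
      refine MulOpposite.unop_injective (LinearMap.ext fun t => ?_)
      change tensorMulRight A (a * b) t = tensorMulRight A b (tensorMulRight A a t)
      induction t with
      | zero => rw [map_zero, map_zero, map_zero]
      | tmul u c => rw [tensorMulRight_tmul, tensorMulRight_tmul, tensorMulRight_tmul, mul_assoc]
      | add s t hs ht => rw [map_add, hs, ht, map_add, map_add])

omit [PoissonOrder k Z A] in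
theorem unop_tensorMul (a : A) (t : PoissonEnvRight k Z ⊗[Z] A) :
    (tensorMul A a).unop t = LinearMap.lTensor (PoissonEnvRight k Z) (LinearMap.mulRight Z a) t :=
  rfl

omit [PoissonOrder k Z A] in
@[simp]
theorem unop_tensorMul_tmul (a b : A) (u : PoissonEnvRight k Z) :
    (tensorMul A a).unop (u ⊗ₜ b) = u ⊗ₜ (b * a) := rfl

/-- The right action of `Aᵉ` on `Zᵉ ⊗ A`. -/
def rep (hLie : ∀ (x y : Z) (a : A),
      PoissonOrder.ham (k := k) (PoissonAlgebra.bracket (k := k) x y) a =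
        PoissonOrder.ham (k := k) x (PoissonOrder.ham (k := k) y a)
          - PoissonOrder.ham (k := k) y (PoissonOrder.ham (k := k) x a)) :
    PoissonEnv k Z A →ₐ[k] (Module.End k (PoissonEnvRight k Z ⊗[Z] A))ᵐᵒᵖ :=
  PoissonEnv.lift (tensorMul A)
    ((MulOpposite.opLinearEquiv k).toLinearMap.comp (tensorOp A))
    (fun x y => by
      refine MulOpposite.unop_injective (LinearMap.ext fun t => ?_)
      induction t with
      | zero => simp
      | add s t hs ht => rw [map_add, hs, ht, map_add]
      | tmul u a =>
        simp only [LinearMap.comp_apply, LinearEquiv.coe_coe, MulOpposite.coe_opLinearEquiv,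
          MulOpposite.unop_op, MulOpposite.unop_sub, MulOpposite.unop_mul, LinearMap.sub_apply,
          Module.End.mul_apply, tensorOp_tmul, map_sub, hLie, mulDelta_bracket,
          TensorProduct.sub_tmul, TensorProduct.tmul_sub]
        abel)
    (fun x a => by
      refine MulOpposite.unop_injective (LinearMap.ext fun t => ?_)
      induction t with
      | zero => simp
      | add s t hs ht => rw [map_add, hs, ht, map_add]
      | tmul u b =>
        simp only [LinearMap.comp_apply, LinearEquiv.coe_coe, MulOpposite.coe_opLinearEquiv,
          MulOpposite.unop_op, MulOpposite.unop_sub, MulOpposite.unop_mul, LinearMap.sub_apply,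
          Module.End.mul_apply, tensorOp_tmul, map_sub, unop_tensorMul_tmul,
          PoissonOrder.ham_mul, TensorProduct.tmul_add]
        abel)
    (fun x y => by
      refine MulOpposite.unop_injective (LinearMap.ext fun t => ?_)
      induction t with
      | zero => simp
      | add s t hs ht => rw [map_add, hs, ht, map_add]
      | tmul u b =>
        -- Moving scalars of `Z` past `δ x` and `δ y` creates terms with `{x, y}` and `{y, x}`,
        -- which cancel by skew-symmetry. `bracket_skew` is instantiated at `y x` so that it does
        -- not loop.
        simp only [LinearMap.comp_apply, LinearEquiv.coe_coe, MulOpposite.coe_opLinearEquiv,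
          MulOpposite.unop_op, MulOpposite.unop_add, MulOpposite.unop_mul, LinearMap.add_apply,
          Module.End.mul_apply, tensorOp_tmul, unop_tensorMul_tmul, PoissonOrder.mul_ham,
          mulDelta_mul, TensorProduct.add_tmul, TensorProduct.tmul_add, ← Algebra.commutes,
          ← Algebra.smul_def, PoissonEnv.ham_smul, mulDelta_smul, TensorProduct.sub_tmul,
          TensorProduct.smul_tmul, PoissonAlgebra.bracket_skew y x, neg_smul,
          TensorProduct.tmul_neg, TensorProduct.neg_tmul]
        abel)

section

variable (hLie : ∀ (x y : Z) (a : A),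
      PoissonOrder.ham (k := k) (PoissonAlgebra.bracket (k := k) x y) a =
        PoissonOrder.ham (k := k) x (PoissonOrder.ham (k := k) y a)
          - PoissonOrder.ham (k := k) y (PoissonOrder.ham (k := k) x a))

@[simp]
theorem rep_alpha (a : A) : rep hLie (PoissonEnv.alpha k Z A a) = tensorMul A a := by
  rw [rep, PoissonEnv.lift_alpha]

@[simp]
theorem rep_delta (x : Z) :
    rep hLie (PoissonEnv.delta k Z A x) = MulOpposite.op (tensorOp A x) := by
  rw [rep, PoissonEnv.lift_delta]; rfl

end

variable (k Z A) in
/-- The map `Zᵉ ⊗ A → Aᵉ`, `u ⊗ a ↦ u * α a`. -/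
def ofTensor : PoissonEnvRight k Z ⊗[Z] A →+ PoissonEnv k Z A :=
  TensorProduct.liftAddHom
    ((AddMonoidHom.mul.compr₂ (AddMonoidHom.id _)).compl₂
      (PoissonEnv.alpha k Z A : A →+ PoissonEnv k Z A) |>.comp
      (PoissonEnv.ofBase k Z A : PoissonEnv k Z Z →+ PoissonEnv k Z A))
    (fun z u a => by
      change PoissonEnv.ofBase k Z A ((of k Z).symm u * PoissonEnv.alpha k Z Z z)
          * PoissonEnv.alpha k Z A a
        = PoissonEnv.ofBase k Z A ((of k Z).symm u) * PoissonEnv.alpha k Z A (z • a)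
      rw [map_mul, PoissonEnv.ofBase_alpha, Algebra.smul_def, map_mul, mul_assoc])

@[simp]
theorem ofTensor_tmul (u : PoissonEnv k Z Z) (a : A) :
    ofTensor k Z A (of k Z u ⊗ₜ a) = PoissonEnv.ofBase k Z A u * PoissonEnv.alpha k Z A a := rfl

theorem ofTensor_smul (u : PoissonEnv k Z Z) (t : PoissonEnvRight k Z ⊗[Z] A) :
    ofTensor k Z A (u • t) = PoissonEnv.ofBase k Z A u * ofTensor k Z A t := by
  induction t with
  | zero => simp
  | tmul v a =>
    rw [TensorProduct.smul_tmul']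
    change PoissonEnv.ofBase k Z A (u * (of k Z).symm v) * PoissonEnv.alpha k Z A a =
      PoissonEnv.ofBase k Z A u *
        (PoissonEnv.ofBase k Z A ((of k Z).symm v) * PoissonEnv.alpha k Z A a)
    rw [map_mul, mul_assoc]
  | add s t hs ht => rw [smul_add, map_add, hs, ht, map_add, mul_add]

theorem ofTensor_tensorOp (x : Z) (t : PoissonEnvRight k Z ⊗[Z] A) :
    ofTensor k Z A (tensorOp A x t) = ofTensor k Z A t * PoissonEnv.delta k Z A x := by
  induction t with
  | zero => simp
  | tmul u a =>
    obtain ⟨u, rfl⟩ := (of k Z).surjective u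
    rw [tensorOp_tmul, map_sub, mulDelta_of, ofTensor_tmul, ofTensor_tmul, ofTensor_tmul, map_mul,
      PoissonEnv.ofBase_delta, mul_assoc, mul_assoc, PoissonEnv.alpha_ham, mul_sub]
    abel
  | add s t hs ht => rw [map_add, map_add, hs, ht, map_add, add_mul]

theorem ofTensor_mulRight (t : PoissonEnvRight k Z ⊗[Z] A) (a : A) :
    ofTensor k Z A (LinearMap.lTensor (PoissonEnvRight k Z) (LinearMap.mulRight Z a) t) =
      ofTensor k Z A t * PoissonEnv.alpha k Z A a := by
  induction t with
  | zero => simp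
  | tmul u b =>
    obtain ⟨u, rfl⟩ := (of k Z).surjective u
    simp [mul_assoc]
  | add s t hs ht => rw [map_add, map_add, hs, ht, map_add, add_mul]

section

variable (hLie : ∀ (x y : Z) (a : A),
      PoissonOrder.ham (k := k) (PoissonAlgebra.bracket (k := k) x y) a =
        PoissonOrder.ham (k := k) x (PoissonOrder.ham (k := k) y a)
          - PoissonOrder.ham (k := k) y (PoissonOrder.ham (k := k) x a))
include hLie

/-- Mirror image of `PoissonEnv.ofTensor_bijective`: the inverse is the orbit map of `1 ⊗ 1` for the
right action, so words are built by multiplying on the right. -/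
theorem ofTensor_bijective : Function.Bijective (ofTensor k Z A) := by
  let r := rep hLie
  have base : ∀ u : PoissonEnv k Z Z,
      (r (PoissonEnv.ofBase k Z A u)).unop (of k Z 1 ⊗ₜ 1) = of k Z u ⊗ₜ 1 := by
    intro u
    induction u using PoissonEnv.gen_induction_right with
    | one => simp
    | add u v hu hv =>
      rw [map_add, map_add, MulOpposite.unop_add, LinearMap.add_apply, hu, hv,
        ← TensorProduct.add_tmul]; rfl
    | smul c u hu =>
      rw [map_smul, map_smul, MulOpposite.unop_smul, LinearMap.smul_apply, hu,
        TensorProduct.smul_tmul']; rfl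
    | mul_alpha z u hu =>
      rw [map_mul, map_mul, MulOpposite.unop_mul, Module.End.mul_apply, hu,
        PoissonEnv.ofBase_alpha, rep_alpha, unop_tensorMul_tmul, one_mul,
        Algebra.algebraMap_eq_smul_one, ← TensorProduct.smul_tmul, smul_def]
    | mul_delta x u hu =>
      rw [map_mul, map_mul, MulOpposite.unop_mul, Module.End.mul_apply, hu,
        PoissonEnv.ofBase_delta, rep_delta, MulOpposite.unop_op, tensorOp_tmul,
        PoissonEnv.ham_one, TensorProduct.tmul_zero, sub_zero, mulDelta_of]
  have inv : ∀ t, (r (ofTensor k Z A t)).unop (of k Z 1 ⊗ₜ 1) = t := by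
    intro t
    induction t with
    | zero => simp
    | tmul u a =>
      obtain ⟨u, rfl⟩ := (of k Z).surjective u
      rw [ofTensor_tmul, map_mul, MulOpposite.unop_mul, Module.End.mul_apply, base, rep_alpha,
        unop_tensorMul_tmul, one_mul]
    | add s t hs ht =>
      rw [map_add, map_add, MulOpposite.unop_add, LinearMap.add_apply, hs, ht]
  refine ⟨fun s t h => by rw [← inv s, h, inv], fun w => ⟨(r w).unop (of k Z 1 ⊗ₜ 1), ?_⟩⟩
  induction w using PoissonEnv.gen_induction_right with
  | one => simp
  | add u v hu hv => rw [map_add, MulOpposite.unop_add, LinearMap.add_apply, map_add, hu, hv]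
  | smul c u hu =>
    -- Scalars of `k` are rewritten as scalars of `Zᵉ`, since `ofTensor` is only additive and
    -- `ofTensor_smul` concerns `Zᵉ`.
    have h : ∀ t : PoissonEnvRight k Z ⊗[Z] A,
        c • t = algebraMap k (PoissonEnv k Z Z) c • t := by
      intro t
      induction t with
      | zero => simp
      | tmul v a =>
        rw [TensorProduct.smul_tmul', TensorProduct.smul_tmul']
        congr 1
      | add s t hs ht => rw [smul_add, hs, ht, smul_add]
    rw [map_smul, MulOpposite.unop_smul, LinearMap.smul_apply, h, ofTensor_smul, hu,
      AlgHom.commutes, Algebra.smul_def]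
  | mul_alpha a u hu =>
    rw [map_mul, MulOpposite.unop_mul, Module.End.mul_apply, rep_alpha, unop_tensorMul,
      ofTensor_mulRight, hu]
  | mul_delta x u hu =>
    rw [map_mul, MulOpposite.unop_mul, Module.End.mul_apply, rep_delta, MulOpposite.unop_op,
      ofTensor_tensorOp, hu]

end

end PoissonEnvRight


/-! ### Hamiltonian actions on symmetric algebras of projective cotangent modules -/

/-! ### Koszul contraction on monomials -/

namespace MvPolynomial

variable {σ R M : Type*} [CommRing R] [AddCommGroup M] [Module R M]

theorem map_eq_of_totalDegree_le {f g : MvPolynomial σ R →ₗ[R] M} {n : ℕ}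
    (h : ∀ s : σ →₀ ℕ, s.degree ≤ n → f (monomial s 1) = g (monomial s 1))
    {p : MvPolynomial σ R} (hp : p.totalDegree ≤ n) : f p = g p := by
  rw [p.as_sum, map_sum, map_sum]
  refine Finset.sum_congr rfl fun s hs => ?_
  have e : monomial s (coeff s p) = coeff s p • monomial s (1 : R) := by
    rw [smul_monomial, smul_eq_mul, mul_one]
  rw [e, map_smul, map_smul, h s ((le_totalDegree hs).trans hp)]

theorem map_mem_of_totalDegree_le {f : MvPolynomial σ R →ₗ[R] M} {n : ℕ} {W : Submodule R M}
    (h : ∀ s : σ →₀ ℕ, s.degree ≤ n → f (monomial s 1) ∈ W)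
    {p : MvPolynomial σ R} (hp : p.totalDegree ≤ n) : f p ∈ W := by
  rw [p.as_sum, map_sum]
  refine sum_mem fun s hs => ?_
  have e : monomial s (coeff s p) = coeff s p • monomial s (1 : R) := by
    rw [smul_monomial, smul_eq_mul, mul_one]
  rw [e, map_smul]
  exact W.smul_mem _ (h s ((le_totalDegree hs).trans hp))

theorem totalDegree_monomial_le_degree (s : σ →₀ ℕ) (c : R) :
    (monomial s c).totalDegree ≤ s.degree :=
  totalDegree_monomial_le s c

/-- The contraction of the Koszul complex in one degree: an alternating cocycle on monomials of
degree `n` is a coboundary. -/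
theorem exists_koszul_primitive [LinearOrder σ] (κ : σ → σ → MvPolynomial σ R →ₗ[R] M) (n : ℕ)
    (alt : ∀ i, κ i i = 0) (skew : ∀ i j, κ i j = - κ j i)
    (cocycle : ∀ i j l (t : σ →₀ ℕ), t.degree + 1 = n →
      κ i j (X l * monomial t 1) + κ j l (X i * monomial t 1) + κ l i (X j * monomial t 1) = 0) :
    ∃ η : σ → MvPolynomial σ R →ₗ[R] M,
      (∀ i (s : σ →₀ ℕ), s.degree ≠ n + 1 → η i (monomial s 1) = 0) ∧
      (∀ W : Submodule R M, (∀ i j (t : σ →₀ ℕ), t.degree = n → κ i j (monomial t 1) ∈ W) →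
        ∀ i p, η i p ∈ W) ∧
      (∀ i j (s : σ →₀ ℕ), s.degree = n →
        η i (X j * monomial s 1) - η j (X i * monomial s 1) = κ i j (monomial s 1)) := by
  -- The homotopy divides by the smallest index among `i` and the variables of `u`. If that index is
  -- `i`, the value is zero because `κ` is alternating; otherwise it divides `u`, so the truncated
  -- subtraction in `v` is genuine.
  let m (i : σ) (u : σ →₀ ℕ) : σ := (insert i u.support).min' (Finset.insert_nonempty _ _)
  have hm : ∀ i u, m i u = i ∨ m i u ∈ u.support := fun i u =>
    Finset.mem_insert.1 (Finset.min'_mem _ (Finset.insert_nonempty _ _))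
  let v (i : σ) (u : σ →₀ ℕ) : M := if u.degree = n + 1 then
    κ i (m i u) (monomial (u - Finsupp.single (m i u) 1) 1) else 0
  have hsplit : ∀ (a : σ) (u : σ →₀ ℕ), a ∈ u.support →
      ∃ t, u = Finsupp.single a 1 + t ∧ t.degree + 1 = u.degree := by
    intro a u ha
    have h : u = Finsupp.single a 1 + (u - Finsupp.single a 1) := by
      rw [add_tsub_cancel_of_le]
      exact Finsupp.single_le_iff.2 (Nat.one_le_iff_ne_zero.2 (Finsupp.mem_support_iff.1 ha))
    refine ⟨_, h, ?_⟩
    conv_rhs => rw [h]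
    rw [map_add, Finsupp.degree_single, add_comm]
  have hX : ∀ (i : σ) (s : σ →₀ ℕ),
      (X i * monomial s 1 : MvPolynomial σ R) = monomial (Finsupp.single i 1 + s) 1 := by
    intro i s
    rw [X, monomial_mul, one_mul]
  let η (i : σ) : MvPolynomial σ R →ₗ[R] M := (basisMonomials σ R).constr R (v i)
  have hη : ∀ i s, η i (monomial s 1) = v i s := fun i s => by
    have := (basisMonomials σ R).constr_basis R (v i) s
    rwa [coe_basisMonomials] at this
  -- Tracking a submodule `W` lets the primitive inherit from `κ` both invariance under a projection
  -- and a degree bound.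
  refine ⟨η, fun i s hs => ?_, fun W hW i p => ?_, fun i j s hs => ?_⟩
  · rw [hη]; exact if_neg hs
  · refine map_mem_of_totalDegree_le (n := p.totalDegree) (fun s _ => ?_) le_rfl
    rw [hη]
    by_cases hs : s.degree = n + 1
    · simp only [v, if_pos hs]
      rcases hm i s with h | h
      · rw [h, alt]; exact W.zero_mem
      · obtain ⟨t, ht, hd⟩ := hsplit _ _ h
        generalize m i s = a at *
        subst ht
        rw [add_tsub_cancel_left]
        exact hW _ _ _ (by omega)
    · simp only [v, if_neg hs]; exact W.zero_mem
  · have hdeg : ∀ a : σ, (Finsupp.single a 1 + s).degree = n + 1 := fun a => by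
      rw [map_add, Finsupp.degree_single, hs, add_comm]
    -- Both are the minimum of `i`, `j` and the variables of `s`, so the two terms of the coboundary
    -- divide by the same variable `a`. If `a` is `i` or `j`, one term vanishes; otherwise `s` is
    -- divisible by `a` and the cocycle identity applies.
    have hmm : m j (Finsupp.single i 1 + s) = m i (Finsupp.single j 1 + s) := by
      have hsupp : ∀ a : σ, (Finsupp.single a 1 + s).support = insert a s.support := by
        intro a
        ext b
        by_cases hab : a = b <;> simp [hab, eq_comm]
      simp only [m, hsupp, Finset.insert_comm]
    rw [hX, hX, hη, hη]
    simp only [v, if_pos (hdeg _), hmm]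
    rcases hm i (Finsupp.single j 1 + s) with h | h
    · rw [h, alt, LinearMap.zero_apply, add_tsub_cancel_left, zero_sub, skew i j,
        LinearMap.neg_apply]
    · generalize m i (Finsupp.single j 1 + s) = a at *
      by_cases haj : a = j
      · subst haj
        rw [alt, LinearMap.zero_apply, sub_zero, add_tsub_cancel_left]
      · have has : a ∈ s.support := by
          simpa [Finsupp.single_apply, Ne.symm haj] using h
        obtain ⟨t, rfl, ht⟩ := hsplit _ _ has
        have h1 : ∀ b : σ, Finsupp.single b 1 + (Finsupp.single a 1 + t) - Finsupp.single a 1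
            = Finsupp.single b 1 + t := fun b => by
          rw [add_left_comm, add_tsub_cancel_left]
        rw [h1, h1, ← hX, ← hX, ← hX]
        have hc := cocycle i j a t (by omega)
        rw [skew a i, LinearMap.neg_apply] at hc
        rw [eq_comm, ← sub_eq_zero, ← hc]
        abel

end MvPolynomial

/-! ### Cotangent frames and the idempotent cutting out `S(Ω)` -/

/-- Elements `z i` and derivations `∂ i` such that `dx = ∑ ∂ i x • d (z i)`: a splitting of the
map from a free module onto the cotangent module. -/
structure CotangentFrame (k Z : Type*) [Field k] [CommRing Z] [Algebra k Z] (r : ℕ) where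
  /-- The elements whose differentials span. -/
  elt : Fin r → Z
  /-- The derivations giving the coordinates of differentials. -/
  der : Fin r → Derivation k Z Z
  D_eq : ∀ x, KaehlerDifferential.D k Z x = ∑ i, der i x • KaehlerDifferential.D k Z (elt i)

namespace CotangentFrame

open MvPolynomial

variable {k Z : Type*} [Field k] [CommRing Z] [Algebra k Z] {r : ℕ} (F : CotangentFrame k Z r)

-- Every derivation factors through `Ω`, so the frame expands it. This expands the curvature in each
-- of its arguments and also shows that `proj` is idempotent.
include F in
theorem derivation_eq {N : Type*} [AddCommGroup N] [Module k N] [Module Z N] [IsScalarTower k Z N]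
    (D : Derivation k Z N) (x : Z) : D x = ∑ i, F.der i x • D (F.elt i) := by
  have h := congrArg D.liftKaehlerDifferential (F.D_eq x)
  simpa using h

/-- The linear form representing the differential `dx`. -/
noncomputable def sym : Derivation k Z (MvPolynomial (Fin r) Z) :=
  ∑ i, (LinearMap.toSpanSingleton Z (MvPolynomial (Fin r) Z) (X i)).compDer (F.der i)

theorem sym_apply (x : Z) : F.sym x = ∑ i, F.der i x • X i := by
  rw [sym, ← Derivation.coeFnAddMonoidHom_apply, map_sum, Finset.sum_apply]
  rfl

/-- The projection of the polynomial ring onto the symmetric algebra of the cotangent module. -/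
noncomputable def proj : MvPolynomial (Fin r) Z →ₐ[Z] MvPolynomial (Fin r) Z :=
  aeval fun j => F.sym (F.elt j)

@[simp]
theorem proj_X (j : Fin r) : F.proj (X j) = F.sym (F.elt j) := aeval_X _ _

-- The map `sym` is itself a derivation, so expanding it in the frame is exactly this identity.
@[simp]
theorem proj_sym (x : Z) : F.proj (F.sym x) = F.sym x := by
  conv_lhs => rw [sym_apply]
  simp only [map_sum, map_smul, proj_X]
  exact (F.derivation_eq F.sym x).symm

@[simp]
theorem proj_proj (p : MvPolynomial (Fin r) Z) : F.proj (F.proj p) = F.proj p := by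
  have h : F.proj.comp F.proj = F.proj := by
    ext j : 1
    simp
  exact DFunLike.congr_fun h p

theorem totalDegree_sym_le (x : Z) : (F.sym x).totalDegree ≤ 1 := by
  rw [sym_apply]
  refine totalDegree_finsetSum_le fun i _ => (totalDegree_smul_le _ _).trans ?_
  exact (totalDegree_monomial_le_degree _ _).trans (by simp)

theorem totalDegree_sym_mul_le (x : Z) (p : MvPolynomial (Fin r) Z) :
    (F.sym x * p).totalDegree ≤ p.totalDegree + 1 :=
  (totalDegree_mul _ _).trans (by have := F.totalDegree_sym_le x; omega)

theorem totalDegree_proj_le (p : MvPolynomial (Fin r) Z) :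
    (F.proj p).totalDegree ≤ p.totalDegree := by
  rw [← mem_restrictTotalDegree]
  refine map_mem_of_totalDegree_le (f := F.proj.toLinearMap) (fun s hs => ?_) le_rfl
  rw [mem_restrictTotalDegree, AlgHom.toLinearMap_apply, proj, aeval_monomial, map_one, one_mul,
    Finsupp.prod]
  refine (totalDegree_finsetProd _ _).trans (le_trans (Finset.sum_le_sum fun i _ => ?_) hs)
  exact (totalDegree_pow _ _).trans
    ((Nat.mul_le_mul_left _ (F.totalDegree_sym_le (F.elt i))).trans (mul_one _).le)

end CotangentFrame

/-! ### The Hamiltonian derivations on coefficients -/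

section Nabla

open MvPolynomial

variable {k Z : Type*} [Field k] [CommRing Z] [Algebra k Z] [PoissonAlgebra k Z] (r : ℕ)

/-- The Hamiltonian derivations of `Z` acting on the coefficients of polynomials. -/
noncomputable def PoissonAlgebra.coeffBracket :
    Z →ₗ[k] Module.End k (MvPolynomial (Fin r) Z) where
  toFun x :=
    { toFun := fun p => AddMonoidAlgebra.map (PoissonAlgebra.bracket (k := k) x).toAddMonoidHom p
      map_add' := fun p q => by ext; simp
      map_smul' := fun c p => by ext; simp }
  map_add' x y := by ext; simp
  map_smul' c x := by ext; simp

variable {r}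

@[simp]
theorem PoissonAlgebra.coeff_coeffBracket (x : Z) (p : MvPolynomial (Fin r) Z) (s : Fin r →₀ ℕ) :
    coeff s (PoissonAlgebra.coeffBracket (k := k) r x p) =
      PoissonAlgebra.bracket (k := k) x (coeff s p) := rfl

theorem PoissonAlgebra.coeffBracket_smul (x c : Z) (p : MvPolynomial (Fin r) Z) :
    PoissonAlgebra.coeffBracket (k := k) r x (c • p) =
      c • PoissonAlgebra.coeffBracket (k := k) r x p + PoissonAlgebra.bracket (k := k) x c • p := by
  ext s
  simp only [coeff_coeffBracket, coeff_smul, coeff_add, smul_eq_mul, leibniz]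
  ring

theorem PoissonAlgebra.coeffBracket_mul (x y : Z) (p : MvPolynomial (Fin r) Z) :
    PoissonAlgebra.coeffBracket (k := k) r (x * y) p =
      x • PoissonAlgebra.coeffBracket (k := k) r y p
        + y • PoissonAlgebra.coeffBracket (k := k) r x p := by
  ext s
  simp [coeff_coeffBracket, coeff_smul, coeff_add, smul_eq_mul, mul_bracket]

theorem PoissonAlgebra.totalDegree_coeffBracket_le (x : Z) (p : MvPolynomial (Fin r) Z) :
    (PoissonAlgebra.coeffBracket (k := k) r x p).totalDegree ≤ p.totalDegree := by
  refine totalDegree_le_of_support_subset fun s hs => ?_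
  rw [mem_support_iff] at hs ⊢
  intro h
  exact hs (by rw [coeff_coeffBracket, h, map_zero])

end Nabla


/-! ### Connections, curvature and the construction of a flat one -/

namespace CotangentFrame

open MvPolynomial PoissonAlgebra

variable {k Z : Type*} [Field k] [CommRing Z] [Algebra k Z] [PoissonAlgebra k Z] {r : ℕ}
  (F : CotangentFrame k Z r)

omit [PoissonAlgebra k Z] in
theorem proj_base_smul (c : k) (p : MvPolynomial (Fin r) Z) : F.proj (c • p) = c • F.proj p := by
  rw [← algebraMap_smul Z c p, map_smul, algebraMap_smul]

/-- The operators `p ↦ dx * p + ∇ x p + ∑ ∂ i x • ω i p` on the polynomial ring. -/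
noncomputable def connFun (ω : Fin r → Module.End Z (MvPolynomial (Fin r) Z)) (x : Z)
    (p : MvPolynomial (Fin r) Z) : MvPolynomial (Fin r) Z :=
  F.sym x * p + F.proj (coeffBracket (k := k) r x p) + ∑ i, F.der i x • ω i p

/-- The operators `p ↦ dx * p + ∇ x p + ∑ ∂ i x • ω i p` on the polynomial ring. -/
noncomputable def conn (ω : Fin r → Module.End Z (MvPolynomial (Fin r) Z)) :
    Z →ₗ[k] Module.End k (MvPolynomial (Fin r) Z) :=
  LinearMap.mk₂ k (F.connFun ω)
    (fun x y p => by
      simp only [connFun, map_add, LinearMap.add_apply, add_mul, add_smul, Finset.sum_add_distrib]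
      abel)
    (fun c x p => by
      simp only [connFun, Derivation.map_smul, map_smul, LinearMap.smul_apply, smul_mul_assoc,
        proj_base_smul, smul_add, Finset.smul_sum, smul_assoc])
    (fun x p q => by
      simp only [connFun, mul_add, map_add, smul_add, Finset.sum_add_distrib]
      abel)
    (fun c x p => by
      have h : ∀ i, ω i (c • p) = c • ω i p := fun i => by
        rw [← algebraMap_smul Z c p, map_smul, algebraMap_smul]
      simp only [connFun, mul_smul_comm, map_smul, smul_add, Finset.smul_sum, proj_base_smul, h,
        smul_comm c])

variable (ω : Fin r → Module.End Z (MvPolynomial (Fin r) Z))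

theorem conn_apply (x : Z) (p : MvPolynomial (Fin r) Z) :
    F.conn ω x p = F.sym x * p + F.proj (coeffBracket (k := k) r x p) + ∑ i, F.der i x • ω i p :=
  rfl

/-- The derivative term contains `proj p`, not `p`, because `∇ₓ` need not preserve the fixed
polynomials and is followed by `proj`. The Leibniz rule thus holds on fixed `p`, and later
identities assume `proj p = p` for this reason. -/
theorem conn_smul (x c : Z) (p : MvPolynomial (Fin r) Z) :
    F.conn ω x (c • p) = c • F.conn ω x p + bracket (k := k) x c • F.proj p := by
  simp only [conn_apply, mul_smul_comm, coeffBracket_smul, map_add, map_smul, smul_add,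
    Finset.smul_sum, smul_comm c]
  abel

theorem conn_mul (x y : Z) (p : MvPolynomial (Fin r) Z) :
    F.conn ω (x * y) p = x • F.conn ω y p + y • F.conn ω x p := by
  simp only [conn_apply, Derivation.leibniz, add_mul, coeffBracket_mul, map_add, map_smul,
    smul_add, Finset.smul_sum, add_smul, Finset.sum_add_distrib, smul_mul_assoc, smul_assoc]
  abel

/-- The curvature of `conn`. -/
noncomputable def curv (x y : Z) (p : MvPolynomial (Fin r) Z) : MvPolynomial (Fin r) Z :=
  F.conn (k := k) ω x (F.conn (k := k) ω y p) - F.conn (k := k) ω y (F.conn (k := k) ω x p)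
    - F.conn (k := k) ω (bracket (k := k) x y) p

/-- Endomorphisms of the polynomial ring that are compatible with the projection and do not raise
the degree. -/
structure IsAdmissible : Prop where
  proj_apply : ∀ i p, F.proj (ω i p) = ω i p
  totalDegree_le : ∀ i p, (ω i p).totalDegree ≤ p.totalDegree

variable {F ω}

theorem IsAdmissible.proj_conn (h : F.IsAdmissible ω) (x : Z) {p : MvPolynomial (Fin r) Z}
    (hp : F.proj p = p) : F.proj (F.conn (k := k) ω x p) = F.conn (k := k) ω x p := by
  simp only [conn_apply, map_add, map_mul, map_sum, map_smul, proj_sym, hp, proj_proj,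
    h.proj_apply]

theorem IsAdmissible.totalDegree_conn_sub_le (h : F.IsAdmissible ω) (x : Z)
    (p : MvPolynomial (Fin r) Z) :
    (F.conn (k := k) ω x p - F.sym x * p).totalDegree ≤ p.totalDegree := by
  rw [conn_apply, add_assoc, add_sub_cancel_left]
  refine (totalDegree_add _ _).trans (max_le ?_ ?_)
  · exact (F.totalDegree_proj_le _).trans (totalDegree_coeffBracket_le _ _)
  · exact totalDegree_finsetSum_le fun i _ =>
      (totalDegree_smul_le _ _).trans (h.totalDegree_le i p)

theorem IsAdmissible.totalDegree_conn_le (h : F.IsAdmissible ω) (x : Z)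
    (p : MvPolynomial (Fin r) Z) :
    (F.conn (k := k) ω x p).totalDegree ≤ p.totalDegree + 1 := by
  rw [← sub_add_cancel (F.conn (k := k) ω x p) (F.sym x * p)]
  exact (totalDegree_add _ _).trans (max_le
    ((h.totalDegree_conn_sub_le x p).trans (Nat.le_succ _)) (F.totalDegree_sym_mul_le x p))

/-- The terms of order two, `dx * dy * p` and `dy * dx * p`, cancel by commutativity. The sharp
bound keeps the correction admissible. -/
theorem IsAdmissible.totalDegree_curv_le (h : F.IsAdmissible ω) (x y : Z)
    (p : MvPolynomial (Fin r) Z) :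
    (F.curv (k := k) ω x y p).totalDegree ≤ p.totalDegree + 1 := by
  have key : ∀ x y : Z, F.conn (k := k) ω x (F.conn (k := k) ω y p) - F.sym x * (F.sym y * p)
      ∈ restrictTotalDegree (Fin r) Z (p.totalDegree + 1) := by
    intro x y
    have e : F.conn (k := k) ω x (F.conn (k := k) ω y p) - F.sym x * (F.sym y * p) =
        (F.conn (k := k) ω x (F.conn (k := k) ω y p) - F.sym x * F.conn (k := k) ω y p)
        + F.sym x * (F.conn (k := k) ω y p - F.sym y * p) := by ring
    rw [e]
    refine add_mem ?_ ?_ <;> rw [mem_restrictTotalDegree]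
    · exact (h.totalDegree_conn_sub_le _ _).trans (h.totalDegree_conn_le _ _)
    · exact (F.totalDegree_sym_mul_le _ _).trans
        (Nat.succ_le_succ (h.totalDegree_conn_sub_le _ _))
  have e : F.curv (k := k) ω x y p =
      (F.conn (k := k) ω x (F.conn (k := k) ω y p) - F.sym x * (F.sym y * p))
      - (F.conn (k := k) ω y (F.conn (k := k) ω x p) - F.sym y * (F.sym x * p))
      - F.conn (k := k) ω (bracket (k := k) x y) p := by
    rw [curv]; ring
  rw [e, ← mem_restrictTotalDegree]
  refine sub_mem (sub_mem (key x y) (key y x)) ?_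
  rw [mem_restrictTotalDegree]
  exact h.totalDegree_conn_le _ _

theorem IsAdmissible.proj_curv (h : F.IsAdmissible ω) (x y : Z) {p : MvPolynomial (Fin r) Z}
    (hp : F.proj p = p) : F.proj (F.curv (k := k) ω x y p) = F.curv (k := k) ω x y p := by
  simp only [curv, map_sub]
  rw [h.proj_conn _ (h.proj_conn _ hp), h.proj_conn _ (h.proj_conn _ hp), h.proj_conn _ hp]

theorem curv_add (x y : Z) (p q : MvPolynomial (Fin r) Z) :
    F.curv (k := k) ω x y (p + q) = F.curv (k := k) ω x y p + F.curv (k := k) ω x y q := by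
  simp only [curv, map_add]; ring

theorem curv_self (x : Z) (p : MvPolynomial (Fin r) Z) : F.curv (k := k) ω x x p = 0 := by
  rw [curv, bracket_self, map_zero, sub_self]; simp

theorem curv_skew (x y : Z) (p : MvPolynomial (Fin r) Z) :
    F.curv (k := k) ω x y p = - F.curv (k := k) ω y x p := by
  rw [curv, curv, bracket_skew x y, map_neg, LinearMap.neg_apply]; ring

/-- Curvature is tensorial: the first derivatives of `c` cancel in the commutator and the second
ones cancel by the Jacobi identity. -/
theorem IsAdmissible.curv_smul (h : F.IsAdmissible ω) (x y c : Z) {p : MvPolynomial (Fin r) Z}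
    (hp : F.proj p = p) : F.curv (k := k) ω x y (c • p) = c • F.curv (k := k) ω x y p := by
  simp only [curv, conn_smul, map_add, hp, h.proj_conn _ hp, bracket_bracket, smul_sub,
    sub_smul]
  abel

/-- This makes the curvature a derivation in `x`, hence determined by its values on the frame
elements. -/
theorem IsAdmissible.curv_mul_left (h : F.IsAdmissible ω) (x x' y : Z)
    {p : MvPolynomial (Fin r) Z} (hp : F.proj p = p) :
    F.curv (k := k) ω (x * x') y p =
      x • F.curv (k := k) ω x' y p + x' • F.curv (k := k) ω x y p := by
  have e : bracket (k := k) (x * x') y = x * bracket (k := k) x' y + x' * bracket (k := k) x y :=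
    mul_bracket x x' y
  simp only [curv, e, conn_mul, conn_smul, map_add, LinearMap.add_apply, h.proj_conn _ hp,
    smul_sub, bracket_skew y x, bracket_skew y x', neg_smul]
  abel

theorem curv_add_left (x x' y : Z) (p : MvPolynomial (Fin r) Z) :
    F.curv (k := k) ω (x + x') y p = F.curv (k := k) ω x y p + F.curv (k := k) ω x' y p := by
  simp only [curv, map_add, LinearMap.add_apply]; ring

theorem curv_smul_left (c : k) (x y : Z) (p : MvPolynomial (Fin r) Z) :
    F.curv (k := k) ω (c • x) y p = c • F.curv (k := k) ω x y p := by
  simp only [curv, map_smul, LinearMap.smul_apply, smul_sub]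

theorem IsAdmissible.curv_eq_sum_left (h : F.IsAdmissible ω) (x y : Z)
    {p : MvPolynomial (Fin r) Z} (hp : F.proj p = p) :
    F.curv (k := k) ω x y p = ∑ i, F.der i x • F.curv (k := k) ω (F.elt i) y p :=
  F.derivation_eq (Derivation.mk' ⟨⟨fun x => F.curv (k := k) ω x y p,
    fun x x' => curv_add_left x x' y p⟩, fun c x => curv_smul_left c x y p⟩
    (fun x x' => h.curv_mul_left x x' y hp)) x

theorem IsAdmissible.curv_eq_sum (h : F.IsAdmissible ω) (x y : Z)
    {p : MvPolynomial (Fin r) Z} (hp : F.proj p = p) :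
    F.curv (k := k) ω x y p =
      ∑ i, ∑ j, (F.der i x * F.der j y) • F.curv (k := k) ω (F.elt i) (F.elt j) p := by
  rw [h.curv_eq_sum_left x y hp]
  refine Finset.sum_congr rfl fun i _ => ?_
  rw [curv_skew, h.curv_eq_sum_left y _ hp, ← Finset.sum_neg_distrib, Finset.smul_sum]
  refine Finset.sum_congr rfl fun j _ => ?_
  rw [curv_skew, smul_neg, smul_neg, smul_neg, neg_neg, smul_smul]

/-- Bianchi identity. As the curvature vanishes at `p`, operators of brackets applied to `p` become
commutators; the triple products cancel in the cyclic sum, and what remains is the Jacobi identity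
in `Z`. -/
theorem curv_bianchi (x y w : Z) (p : MvPolynomial (Fin r) Z)
    (hp : ∀ u v, F.curv (k := k) ω u v p = 0) :
    F.curv (k := k) ω x y (F.conn (k := k) ω w p) + F.curv (k := k) ω y w (F.conn (k := k) ω x p)
      + F.curv (k := k) ω w x (F.conn (k := k) ω y p) = 0 := by
  have hb : ∀ u v, F.conn (k := k) ω (bracket (k := k) u v) p =
      F.conn (k := k) ω u (F.conn (k := k) ω v p) - F.conn (k := k) ω v (F.conn (k := k) ω u p) :=
    fun u v => (sub_eq_zero.1 (hp u v)).symm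
  have h1 : ∀ u v t, F.conn (k := k) ω (bracket (k := k) u v) (F.conn (k := k) ω t p) =
      F.conn (k := k) ω t (F.conn (k := k) ω u (F.conn (k := k) ω v p))
      - F.conn (k := k) ω t (F.conn (k := k) ω v (F.conn (k := k) ω u p))
      - F.conn (k := k) ω (bracket (k := k) t (bracket (k := k) u v)) p := by
    intro u v t
    rw [hb t, hb u v, map_sub]; ring
  have hj : F.conn (k := k) ω (bracket (k := k) x (bracket (k := k) y w)) p
      + F.conn (k := k) ω (bracket (k := k) y (bracket (k := k) w x)) p
      + F.conn (k := k) ω (bracket (k := k) w (bracket (k := k) x y)) p = 0 := by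
    rw [← LinearMap.add_apply, ← LinearMap.add_apply, ← map_add, ← map_add, jacobi, map_zero,
      LinearMap.zero_apply]
  simp only [curv, h1]
  linear_combination hj

variable (F ω) in
/-- The vanishing of the curvature in degrees less than `n`. -/
def FlatBelow (k : Type*) {Z : Type*} [Field k] [CommRing Z] [Algebra k Z] [PoissonAlgebra k Z]
    {r : ℕ} (F : CotangentFrame k Z r) (ω : Fin r → Module.End Z (MvPolynomial (Fin r) Z))
    (n : ℕ) : Prop :=
  ∀ p, F.proj p = p → p.totalDegree < n → ∀ x y, F.curv (k := k) ω x y p = 0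

/-- The inductive step: a correction `η` living on monomials of degree `n + 1` changes the curvature
on degree `n` by the Koszul coboundary of `η` and leaves lower degrees alone. So it suffices that
the curvature in degree `n` is a coboundary. -/
theorem exists_flatBelow_succ (h : F.IsAdmissible ω) {n : ℕ} (hn : FlatBelow k F ω n) :
    ∃ ω', F.IsAdmissible ω' ∧ FlatBelow k F ω' (n + 1) ∧
      ∀ i p, p.totalDegree ≤ n → ω' i p = ω i p := by
  -- The sign makes the correction cancel the curvature. Composing with `proj` gives a `Z`-linear
  -- map on all polynomials, since linearity of the curvature is known only on fixed ones.
  let κ (i j : Fin r) : MvPolynomial (Fin r) Z →ₗ[Z] MvPolynomial (Fin r) Z :=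
    { toFun := fun p => - F.curv (k := k) ω (F.elt i) (F.elt j) (F.proj p)
      map_add' := fun p q => by rw [map_add, curv_add, neg_add]
      map_smul' := fun c p => by
        rw [map_smul, h.curv_smul _ _ _ (F.proj_proj p), RingHom.id_apply, smul_neg] }
  have hκ : ∀ i j p, κ i j p = - F.curv (k := k) ω (F.elt i) (F.elt j) (F.proj p) :=
    fun _ _ _ => rfl
  obtain ⟨η, η_zero, η_mem, η_eq⟩ := exists_koszul_primitive κ n
    (fun i => by refine LinearMap.ext fun p => ?_; rw [hκ, curv_self, neg_zero]; rfl)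
    (fun i j => by refine LinearMap.ext fun p => ?_; rw [LinearMap.neg_apply, hκ, hκ, curv_skew])
    (fun i j l t ht => by
      have hp : F.proj (F.proj (monomial t 1)) = F.proj (monomial t 1) := F.proj_proj _
      have hd : (F.proj (monomial t 1)).totalDegree < n := by
        have := (F.totalDegree_proj_le (monomial t 1)).trans (totalDegree_monomial_le_degree t 1)
        omega
      -- Multiplication by `d (z l)` may be replaced by `conn`: the difference has degree below `n`,
      -- where the curvature already vanishes. The cocycle condition then becomes the Bianchi
      -- identity.
      have hs : ∀ i j l : Fin r, κ i j (X l * monomial t 1) =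
          - F.curv (k := k) ω (F.elt i) (F.elt j)
            (F.conn (k := k) ω (F.elt l) (F.proj (monomial t 1))) := by
        intro i j l
        have e : F.conn (k := k) ω (F.elt l) (F.proj (monomial t 1)) =
            F.sym (F.elt l) * F.proj (monomial t 1)
            + (F.conn (k := k) ω (F.elt l) (F.proj (monomial t 1))
              - F.sym (F.elt l) * F.proj (monomial t 1)) := by ring
        rw [e, curv_add, hn _ ?_ ((h.totalDegree_conn_sub_le _ _).trans_lt hd), add_zero, hκ,
          map_mul, proj_X]
        rw [map_sub, h.proj_conn _ hp, map_mul, proj_sym, hp]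
      rw [hs, hs, hs, ← neg_add, ← neg_add, neg_eq_zero]
      exact curv_bianchi _ _ _ _ (fun u v => hn _ hp hd u v))
  have η_low : ∀ i p, p.totalDegree ≤ n → η i p = 0 := fun i p hp =>
    map_eq_of_totalDegree_le (g := 0) (fun s hs => η_zero i s (by omega)) hp
  have η_proj : ∀ i p, F.proj (η i p) = η i p := fun i p => by
    have := η_mem (LinearMap.ker (F.proj.toLinearMap - LinearMap.id)) (fun i j t _ => by
      rw [LinearMap.mem_ker, LinearMap.sub_apply, AlgHom.toLinearMap_apply, hκ, map_neg,
        h.proj_curv _ _ (F.proj_proj _), LinearMap.id_apply, sub_self]) i p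
    simpa [sub_eq_zero] using this
  have η_deg : ∀ i p, (η i p).totalDegree ≤ n + 1 := fun i p => by
    rw [← mem_restrictTotalDegree]
    refine η_mem _ (fun i j t ht => ?_) i p
    rw [hκ, neg_mem_iff, mem_restrictTotalDegree]
    have := (F.totalDegree_proj_le (monomial t 1)).trans (totalDegree_monomial_le_degree t 1)
    exact (h.totalDegree_curv_le _ _ _).trans (by omega)
  have η_koszul : ∀ i j p, p.totalDegree ≤ n → η i (X j * p) - η j (X i * p) = κ i j p := by
    intro i j p hp
    refine map_eq_of_totalDegree_le (f := (η i).comp (LinearMap.mulLeft Z (X j))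
      - (η j).comp (LinearMap.mulLeft Z (X i))) (fun s hs => ?_) hp
    change η i (X j * monomial s 1) - η j (X i * monomial s 1) = _
    rcases hs.lt_or_eq with hs | hs
    · have hx : ∀ i : Fin r, (X i * monomial s (1 : Z)).totalDegree ≤ n := fun i =>
        (totalDegree_mul _ _).trans (by
          have h1 := totalDegree_monomial_le_degree s (1 : Z)
          have h2 : (X i : MvPolynomial (Fin r) Z).totalDegree ≤ 1 :=
            (totalDegree_monomial_le_degree _ _).trans (by simp)
          omega)
      rw [η_low _ _ (hx j), η_low _ _ (hx i), hκ, hn _ (F.proj_proj _), sub_zero, neg_zero]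
      have := (F.totalDegree_proj_le (monomial s 1)).trans (totalDegree_monomial_le_degree s 1)
      omega
    · exact η_eq i j s hs
  refine ⟨fun i => ω i + η i, ⟨fun i p => ?_, fun i p => ?_⟩, fun p hp hd x y => ?_,
    fun i p hp => ?_⟩
  · rw [LinearMap.add_apply, map_add, h.proj_apply, η_proj]
  · by_cases hp : p.totalDegree ≤ n
    · rw [LinearMap.add_apply, η_low i p hp, add_zero]; exact h.totalDegree_le i p
    · refine (totalDegree_add _ _).trans (max_le (h.totalDegree_le i p) ?_)
      exact (η_deg i p).trans (by omega)
  · have hp' : p.totalDegree ≤ n := Nat.lt_succ_iff.1 hd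
    have hconn : ∀ x q, F.conn (k := k) (fun i => ω i + η i) x q =
        F.conn (k := k) ω x q + ∑ i, F.der i x • η i q := fun x q => by
      simp only [conn_apply, LinearMap.add_apply, smul_add, Finset.sum_add_distrib]; abel
    have hlow : ∀ x q, q.totalDegree ≤ n →
        F.conn (k := k) (fun i => ω i + η i) x q = F.conn (k := k) ω x q := fun x q hq => by
      rw [hconn, Finset.sum_eq_zero, add_zero]
      exact fun i _ => by rw [η_low i q hq, smul_zero]
    -- Only the term `dy * p` of the inner operator can reach degree `n + 1`; `η` kills the rest.
    have htwo : ∀ x y, F.conn (k := k) (fun i => ω i + η i) x (F.conn (k := k) ω y p) =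
        F.conn (k := k) ω x (F.conn (k := k) ω y p)
          + ∑ i, ∑ j, (F.der i x * F.der j y) • η i (X j * p) := fun x y => by
      rw [hconn]
      congr 1
      refine Finset.sum_congr rfl fun i _ => ?_
      rw [← sub_add_cancel (F.conn (k := k) ω y p) (F.sym y * p), map_add,
        η_low i _ ((h.totalDegree_conn_sub_le _ _).trans hp'), zero_add, sym_apply,
        Finset.sum_mul, map_sum, Finset.smul_sum]
      refine Finset.sum_congr rfl fun j _ => ?_
      rw [smul_mul_assoc, map_smul, smul_smul]
    rw [curv, hlow _ _ hp', hlow _ _ hp', hlow _ _ hp', htwo, htwo]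
    have e1 : ∑ i, ∑ j, (F.der i y * F.der j x) • η i (X j * p) =
        ∑ i, ∑ j, (F.der i x * F.der j y) • η j (X i * p) := by
      rw [Finset.sum_comm]
      simp only [mul_comm]
    have e2 : ∑ i, ∑ j, (F.der i x * F.der j y) • η i (X j * p)
        - ∑ i, ∑ j, (F.der i x * F.der j y) • η j (X i * p) = - F.curv (k := k) ω x y p := by
      rw [h.curv_eq_sum x y hp, ← Finset.sum_sub_distrib, ← Finset.sum_neg_distrib]
      refine Finset.sum_congr rfl fun i _ => ?_
      rw [← Finset.sum_sub_distrib, ← Finset.sum_neg_distrib]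
      refine Finset.sum_congr rfl fun j _ => ?_
      rw [← smul_sub, η_koszul i j p hp', hκ, hp, smul_neg]
    have e3 : F.curv (k := k) ω x y p = F.conn (k := k) ω x (F.conn (k := k) ω y p)
      - F.conn (k := k) ω y (F.conn (k := k) ω x p)
      - F.conn (k := k) ω (bracket (k := k) x y) p := rfl
    rw [e1]
    linear_combination e2 - e3
  · rw [LinearMap.add_apply, η_low i p hp, add_zero]

variable (k F) in
/-- Admissible endomorphisms with vanishing curvature in all degrees less than `n`. -/
noncomputable def flatSeq : (n : ℕ) →
    {ω : Fin r → Module.End Z (MvPolynomial (Fin r) Z) // F.IsAdmissible ω ∧ FlatBelow k F ω n}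
  -- No polynomial has degree less than `0`, so flatness below `0` is vacuous.
  | 0 => ⟨fun _ => 0, ⟨fun _ _ => by simp, fun _ _ => by simp⟩, fun _ _ h => by simp at h⟩
  | n + 1 => ⟨_, (exists_flatBelow_succ (flatSeq n).2.1 (flatSeq n).2.2).choose_spec.1,
      (exists_flatBelow_succ (flatSeq n).2.1 (flatSeq n).2.2).choose_spec.2.1⟩

theorem flatSeq_apply (n m : ℕ) (hnm : n ≤ m) (i : Fin r) (p : MvPolynomial (Fin r) Z)
    (hp : p.totalDegree ≤ n) : (flatSeq k F m).1 i p = (flatSeq k F n).1 i p := by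
  induction m, hnm using Nat.le_induction with
  | base => rfl
  | succ m hm ih =>
    rw [← ih]
    exact (exists_flatBelow_succ (flatSeq k F m).2.1 (flatSeq k F m).2.2).choose_spec.2.2 i p
      (hp.trans hm)

-- The corrections stabilise on each polynomial by `flatSeq_apply`, so reading the value on a
-- monomial from the stage equal to its degree defines a limit that is flat in all degrees.
variable (k F) in
theorem exists_flat : ∃ ω, F.IsAdmissible ω ∧ ∀ n, FlatBelow k F ω n := by
  let Ω (i : Fin r) : Module.End Z (MvPolynomial (Fin r) Z) :=
    (basisMonomials (Fin r) Z).constr Z fun s => (flatSeq k F s.degree).1 i (monomial s 1)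
  have hΩ : ∀ n i (p : MvPolynomial (Fin r) Z), p.totalDegree ≤ n →
      Ω i p = (flatSeq k F n).1 i p := by
    intro n i p hp
    refine map_eq_of_totalDegree_le (fun s hs => ?_) hp
    have := (basisMonomials (Fin r) Z).constr_basis Z
      (fun s => (flatSeq k F s.degree).1 i (monomial s 1)) s
    rw [coe_basisMonomials] at this
    rw [flatSeq_apply _ _ hs i _ (totalDegree_monomial_le_degree s 1), ← this]
  have hc : ∀ n x (p : MvPolynomial (Fin r) Z), p.totalDegree ≤ n →
      F.conn (k := k) Ω x p = F.conn (k := k) (flatSeq k F n).1 x p := fun n x p hp => by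
    rw [conn_apply, conn_apply]
    simp only [hΩ n _ p hp]
  refine ⟨Ω, ⟨fun i p => ?_, fun i p => ?_⟩, fun n p hp _ x y => ?_⟩
  · rw [hΩ _ i p le_rfl, (flatSeq k F _).2.1.proj_apply]
  · rw [hΩ _ i p le_rfl]
    exact (flatSeq k F _).2.1.totalDegree_le i p
  -- The curvature applies two operators in succession, and the first may raise the degree by one;
  -- this stage therefore computes the whole expression and is flat at `p`.
  · have ha := (flatSeq k F (p.totalDegree + 1)).2.1
    rw [curv, hc (p.totalDegree + 1) y p (Nat.le_succ _),
      hc (p.totalDegree + 1) x p (Nat.le_succ _), hc (p.totalDegree + 1) _ p (Nat.le_succ _),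
      hc _ _ _ (ha.totalDegree_conn_le x p), hc _ _ _ (ha.totalDegree_conn_le y p)]
    exact (flatSeq k F (p.totalDegree + 1)).2.2 p hp (Nat.lt_succ_self _) x y

variable (F) in
/-- The fixed points of the projection: a copy of the symmetric algebra of the cotangent module. -/
noncomputable def fixed : Submodule Z (MvPolynomial (Fin r) Z) :=
  LinearMap.eqLocus F.proj.toLinearMap LinearMap.id

omit [PoissonAlgebra k Z] in
theorem mem_fixed {p : MvPolynomial (Fin r) Z} : p ∈ F.fixed ↔ F.proj p = p := Iff.rfl

variable (k F) in
/-- The symmetric algebra of the cotangent module carries a Hamiltonian action for which `x` acts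
as multiplication by `dx` up to terms of lower degree. -/
theorem exists_hamiltonianAction : ∃ e : HamiltonianAction k Z F.fixed, ∀ x (p : F.fixed),
    ((e.op x p : MvPolynomial (Fin r) Z) - F.sym x * p).totalDegree
      ≤ (p : MvPolynomial (Fin r) Z).totalDegree := by
  obtain ⟨ω, h, hflat⟩ := exists_flat k F
  refine ⟨
    { op := LinearMap.mk₂ k (fun x p => ⟨F.conn (k := k) ω x p, h.proj_conn x p.2⟩)
        (fun x y p => Subtype.ext (by simp)) (fun c x p => Subtype.ext (by simp))
        (fun x p q => Subtype.ext (by simp)) (fun c x p => Subtype.ext (by simp))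
      op_smul := fun x c p => Subtype.ext ?_
      op_mul := fun x y p => Subtype.ext (F.conn_mul ω x y p)
      op_bracket := fun x y p => Subtype.ext ?_ }, fun x p => h.totalDegree_conn_sub_le x p⟩
  · have := F.conn_smul (k := k) ω x c p
    rwa [mem_fixed.1 p.2] at this
  · exact (sub_eq_zero.1 (hflat _ p p.2 (Nat.lt_succ_self _) x y)).symm

end CotangentFrame


/-! ### The natural homomorphism to the associated graded algebra -/

namespace FilteredAlgebra

variable {k R : Type*} [Field k] [Ring R] [Algebra k R] (F : ℕ → Submodule k R)

theorem symb_congr {i j : ℕ} {x y : R} (hx : x ∈ F i) (hy : y ∈ F j) (hij : i = j)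
    (hxy : x = y) : symb F i x hx = symb F j y hy := by
  subst hij hxy; rfl

theorem symb_add {i : ℕ} {x y : R} (hx : x ∈ F i) (hy : y ∈ F i) :
    symb F i (x + y) (add_mem hx hy) = symb F i x hx + symb F i y hy :=
  map_add (DirectSum.of (Piece F) i) (cls F x hx) (cls F y hy)

theorem symb_smul {i : ℕ} {x : R} (hx : x ∈ F i) (c : k) :
    symb F i (c • x) ((F i).smul_mem c hx) = c • symb F i x hx :=
  (DirectSum.lof k ℕ (Piece F) i).map_smul c (cls F x hx)

theorem symb_zero {i : ℕ} : symb F i 0 (zero_mem _) = 0 :=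
  map_zero (DirectSum.of (Piece F) i)

theorem symb_eq_of_sub_mem {i : ℕ} {x y : R} (hx : x ∈ F i) (hy : y ∈ F i)
    (h : x - y ∈ lt F i) : symb F i x hx = symb F i y hy :=
  congrArg (DirectSum.of (Piece F) i) (cls_eq F hx hy h)

@[elab_as_elim]
theorem symb_induction {p : Gr F → Prop} (zero : p 0)
    (symb : ∀ i x hx, p (symb F i x hx)) (add : ∀ g h, p g → p h → p (g + h)) (g : Gr F) :
    p g := by
  induction g using DirectSum.induction_on with
  | zero => exact zero
  | of i a =>
    obtain ⟨x, hx, rfl⟩ := exists_cls F a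
    exact symb i x hx
  | add g h hg hh => exact add g h hg hh

variable [IsFilt F]

theorem symb_mul {i j : ℕ} {x y : R} (hx : x ∈ F i) (hy : y ∈ F j) :
    symb F i x hx * symb F j y hy = symb F (i + j) (x * y) (IsFilt.mul_mem hx hy) :=
  DirectSum.of_mul_of (A := Piece F) (cls F x hx) (cls F y hy)

theorem symb_one : symb F 0 1 IsFilt.one_mem = 1 := rfl

end FilteredAlgebra

namespace PoissonEnv

open FilteredAlgebra

variable {k Z A : Type*} [Field k] [CommRing Z] [Algebra k Z] [PoissonAlgebra k Z]
  [Ring A] [Algebra k A] [Algebra Z A] [IsScalarTower k Z A] [PoissonOrder k Z A]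

variable (k Z A) in
/-- The class of `α a` in the associated graded algebra, as a homomorphism. -/
def alphaGr : A →ₐ[k] Gr (filt k Z A) :=
  AlgHom.ofLinearMap
    { toFun := fun a => symb (filt k Z A) 0 (alpha k Z A a) (alpha_mem k Z A a)
      map_add' := fun a b => by
        rw [← symb_add]; exact symb_congr _ _ _ rfl (map_add _ a b)
      map_smul' := fun c a => by
        rw [RingHom.id_apply, ← symb_smul]; exact symb_congr _ _ _ rfl (map_smul _ c a) }
    (by rw [← symb_one]; exact symb_congr _ _ _ rfl (map_one _))
    (fun a b => by
      change symb _ 0 _ _ = symb _ 0 _ _ * symb _ 0 _ _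
      rw [symb_mul]; exact symb_congr _ _ _ rfl (map_mul _ a b))

theorem alphaGr_apply (a : A) :
    alphaGr k Z A a = symb (filt k Z A) 0 (alpha k Z A a) (alpha_mem k Z A a) := rfl

variable (k Z A) in
/-- The class of `δ z` in the associated graded algebra. -/
def deltaGr : Z →ₗ[k] Gr (filt k Z A) where
  toFun z := symb (filt k Z A) 1 (delta k Z A z) (delta_mem k Z A z)
  map_add' x y := by
    rw [← symb_add]; exact symb_congr _ _ _ rfl (map_add _ x y)
  map_smul' c x := by
    rw [RingHom.id_apply, ← symb_smul]; exact symb_congr _ _ _ rfl (map_smul _ c x)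

theorem deltaGr_apply (z : Z) :
    deltaGr k Z A z = symb (filt k Z A) 1 (delta k Z A z) (delta_mem k Z A z) := rfl

/-- The commutator of `δ z` and `α a` is `α {z, a}`, which has filtration degree `0` instead of `1`.
-/
theorem commute_alphaGr_deltaGr (a : A) (z : Z) :
    Commute (alphaGr k Z A a) (deltaGr k Z A z) := by
  rw [commute_iff_eq, alphaGr_apply, deltaGr_apply, symb_mul, symb_mul]
  refine symb_eq_of_sub_mem (filt k Z A) (i := 1) _ _ ?_
  change _ ∈ filt k Z A 0
  rw [← neg_sub, ← alpha_ham]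
  exact neg_mem (alpha_mem k Z A _)

theorem commute_deltaGr_deltaGr (x y : Z) :
    Commute (deltaGr k Z A x) (deltaGr k Z A y) := by
  rw [commute_iff_eq, deltaGr_apply, deltaGr_apply, symb_mul, symb_mul]
  refine symb_eq_of_sub_mem (filt k Z A) (i := 2) _ _ ?_
  change _ ∈ filt k Z A 1
  rw [← delta_bracket]
  exact delta_mem k Z A _

theorem deltaGr_mul (x y : Z) : deltaGr k Z A (x * y) =
    alphaGr k Z A (algebraMap Z A x) * deltaGr k Z A y
      + alphaGr k Z A (algebraMap Z A y) * deltaGr k Z A x := by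
  simp only [alphaGr_apply, deltaGr_apply, symb_mul]
  exact (symb_congr _ _ (add_mem (IsFilt.mul_mem (alpha_mem k Z A _) (delta_mem k Z A y))
    (IsFilt.mul_mem (alpha_mem k Z A _) (delta_mem k Z A x))) rfl (delta_mul k Z A x y)).trans
    (symb_add (filt k Z A) (i := 1) _ _)

theorem list_prod_mem_filt (l : List (A ⊕ Z)) :
    (l.map (gen k Z A)).prod ∈ filt k Z A (l.countP Sum.isRight) :=
  Submodule.subset_span ⟨l, le_rfl, rfl⟩

-- The class of a word with exactly `i` factors `δ` is the product of the classes of its letters,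
-- and the class in degree `i` of a shorter word is zero.
variable (k Z A) in
theorem adjoin_gr_eq_top :
    Algebra.adjoin k (Set.range (alphaGr k Z A) ∪ Set.range (deltaGr k Z A)) = ⊤ := by
  set S := Algebra.adjoin k (Set.range (alphaGr k Z A) ∪ Set.range (deltaGr k Z A))
  have hlist : ∀ l : List (A ⊕ Z), symb (filt k Z A) _ _ (list_prod_mem_filt l) ∈ S := by
    intro l
    induction l with
    | nil => exact one_mem S
    | cons s l ih =>
      rcases s with a | z
      · have hc : (Sum.inl a :: l : List (A ⊕ Z)).countP Sum.isRight = 0 + l.countP Sum.isRight := by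
          rw [List.countP_cons, add_comm]; rfl
        have h : alphaGr k Z A a ∈ S := Algebra.subset_adjoin (Or.inl ⟨a, rfl⟩)
        have := mul_mem h ih
        rw [alphaGr_apply, symb_mul] at this
        rwa [symb_congr (filt k Z A) (list_prod_mem_filt (.inl a :: l))
          (IsFilt.mul_mem (alpha_mem k Z A a) (list_prod_mem_filt l)) hc
          (by rw [List.map_cons, List.prod_cons]; rfl)]
      · have hc : (Sum.inr z :: l : List (A ⊕ Z)).countP Sum.isRight = 1 + l.countP Sum.isRight := by
          rw [List.countP_cons, add_comm]; rfl
        have h : deltaGr k Z A z ∈ S := Algebra.subset_adjoin (Or.inr ⟨z, rfl⟩)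
        have := mul_mem h ih
        rw [deltaGr_apply, symb_mul] at this
        rwa [symb_congr (filt k Z A) (list_prod_mem_filt (.inr z :: l))
          (IsFilt.mul_mem (delta_mem k Z A z) (list_prod_mem_filt l)) hc
          (by rw [List.map_cons, List.prod_cons]; rfl)]
  refine eq_top_iff.2 fun g _ => ?_
  induction g using symb_induction with
  | zero => exact zero_mem S
  | add g h hg hh => exact add_mem (hg trivial) (hh trivial)
  | symb i w hw =>
    clear * - hlist
    change w ∈ Submodule.span k _ at hw
    induction hw using Submodule.span_induction with
    | mem w h =>
      obtain ⟨l, hl, rfl⟩ := h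
      rcases hl.lt_or_eq with hl | rfl
      · convert zero_mem S
        rw [← symb_zero]
        refine symb_eq_of_sub_mem _ _ _ ?_
        rw [sub_zero]
        cases i with
        | zero => exact absurd hl (Nat.not_lt_zero _)
        | succ i => exact Submodule.subset_span ⟨l, Nat.lt_succ_iff.1 hl, rfl⟩
      · exact hlist l
    | zero => convert zero_mem S; exact symb_zero _
    | add x y hx hy hx' hy' => convert add_mem hx' hy'; exact symb_add _ hx hy
    | smul c x hx hx' => convert S.smul_mem hx' c; exact symb_smul _ hx c

/-- Centrality of `Z` in the graded algebra, though not in `Aᵉ`, makes the former a `Z`-algebra, so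
that universal properties over `Z` apply. -/
theorem commute_alphaGr_algebraMap (z : Z) (g : Gr (filt k Z A)) :
    Commute (alphaGr k Z A (algebraMap Z A z)) g := by
  have hg : g ∈ Algebra.adjoin k (Set.range (alphaGr k Z A) ∪ Set.range (deltaGr k Z A)) := by
    rw [adjoin_gr_eq_top]; trivial
  induction hg using Algebra.adjoin_induction with
  | mem x hx =>
    rcases hx with ⟨a, rfl⟩ | ⟨y, rfl⟩
    · exact Commute.map (f := alphaGr k Z A) (Algebra.commutes z a)
    · exact commute_alphaGr_deltaGr _ _
  | algebraMap c => exact Algebra.commute_algebraMap_right c _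
  | add x y _ _ hx hy => exact hx.add_right hy
  | mul x y _ _ hx hy => exact hx.mul_right hy

instance algebraGr : Algebra Z (Gr (filt k Z A)) :=
  ((alphaGr k Z A : A →+* Gr (filt k Z A)).comp (algebraMap Z A)).toAlgebra'
    commute_alphaGr_algebraMap

instance : IsScalarTower k Z (Gr (filt k Z A)) :=
  IsScalarTower.of_algebraMap_eq fun c => by
    change _ = alphaGr k Z A (algebraMap Z A (algebraMap k Z c))
    rw [← IsScalarTower.algebraMap_apply, AlgHom.commutes]

variable (k Z A) in
/-- The class of `δ z` in the associated graded algebra, as a derivation of `Z`. -/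
def deltaDer : Derivation k Z (Gr (filt k Z A)) :=
  Derivation.mk' (deltaGr k Z A) deltaGr_mul

end PoissonEnv

-- The symmetric algebra maps to commutative algebras only, but the image of `f` generates a
-- commutative subalgebra. Recording that values stay there lets commutation with other elements be
-- tested on the range of `f`.
open scoped IsMulCommutative in
theorem SymmetricAlgebra.exists_lift_of_commute {R M B : Type*} [CommRing R] [AddCommGroup M]
    [Module R M] [Ring B] [Algebra R B] (f : M →ₗ[R] B) (hf : ∀ x y, Commute (f x) (f y)) :
    ∃ g : SymmetricAlgebra R M →ₐ[R] B, (∀ x, g (ι R M x) = f x) ∧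
      ∀ x, g x ∈ Algebra.adjoin R (Set.range f) := by
  have := Algebra.isMulCommutative_adjoin R (s := Set.range f) (by
    rintro _ ⟨x, rfl⟩ _ ⟨y, rfl⟩; exact hf x y)
  let f' : M →ₗ[R] Algebra.adjoin R (Set.range f) :=
    { toFun := fun x => ⟨f x, Algebra.subset_adjoin ⟨x, rfl⟩⟩
      map_add' := fun x y => Subtype.ext (map_add f x y)
      map_smul' := fun c x => Subtype.ext (map_smul f c x) }
  let g := lift (A := Algebra.adjoin R (Set.range f)) f'
  have hg : ∀ x, g (ι R M x) = f' x := lift_ι_apply f'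
  refine ⟨(Algebra.adjoin R (Set.range f)).val.comp g, fun x => ?_, fun x => ?_⟩
  · exact congrArg Subtype.val (hg x)
  · exact (g x).2

namespace PoissonEnv

open FilteredAlgebra

variable {k Z A : Type*} [Field k] [CommRing Z] [Algebra k Z] [PoissonAlgebra k Z]
  [Ring A] [Algebra k A] [Algebra Z A] [IsScalarTower k Z A] [PoissonOrder k Z A]

variable (k Z A) in
theorem exists_isNatural :
    ∃ φ : A ⊗[Z] SymmetricAlgebra Z (Ω[Z⁄k]) →ₐ[k] Gr (filt k Z A), IsNatural k Z A φ := by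
  let d : Ω[Z⁄k] →ₗ[Z] Gr (filt k Z A) := (deltaDer k Z A).liftKaehlerDifferential
  have hd : ∀ z, d (KaehlerDifferential.D k Z z) = deltaGr k Z A z := fun z =>
    (deltaDer k Z A).liftKaehlerDifferential_comp_D z
  have hcomm : ∀ (g : Gr (filt k Z A)), (∀ z, Commute g (deltaGr k Z A z)) →
      ∀ x, Commute g (d x) := by
    intro g hg x
    have hx : x ∈ Submodule.span Z (Set.range (KaehlerDifferential.D k Z)) := by
      rw [KaehlerDifferential.span_range_derivation]; trivial
    induction hx using Submodule.span_induction with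
    | mem x h => obtain ⟨z, rfl⟩ := h; rw [hd]; exact hg z
    | zero => rw [map_zero]; exact Commute.zero_right g
    | add x y _ _ hx hy => rw [map_add]; exact hx.add_right hy
    | smul c x _ hx => rw [map_smul]; exact hx.smul_right c
  obtain ⟨s, hs, hs'⟩ := SymmetricAlgebra.exists_lift_of_commute d
    (fun x y => hcomm _ (fun z => (hcomm _ (fun w => commute_deltaGr_deltaGr z w) x).symm) y)
  let a : A →ₐ[Z] Gr (filt k Z A) :=
    { (alphaGr k Z A : A →+* Gr (filt k Z A)) with commutes' := fun z => rfl }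
  let φ : A ⊗[Z] SymmetricAlgebra Z (Ω[Z⁄k]) →ₐ[Z] Gr (filt k Z A) :=
    Algebra.TensorProduct.lift a s (fun x y => by
      have hy := hs' y
      generalize s y = y at hy
      induction hy using Algebra.adjoin_induction with
      | mem y h =>
        obtain ⟨y, rfl⟩ := h
        exact hcomm _ (commute_alphaGr_deltaGr x) y
      | algebraMap c => exact Algebra.commute_algebraMap_right c _
      | add x y _ _ hx hy => exact hx.add_right hy
      | mul x y _ _ hx hy => exact hx.mul_right hy)
  refine ⟨φ.restrictScalars k, fun x => ?_, fun z => ?_⟩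
  · change φ (x ⊗ₜ 1) = _
    rw [Algebra.TensorProduct.lift_tmul, map_one, mul_one]; rfl
  · change φ (1 ⊗ₜ _) = _
    rw [Algebra.TensorProduct.lift_tmul, map_one, one_mul, hs, hd]; rfl

-- Coefficients from `Z` can be moved into the factor `A`, so `k`-algebra generation suffices. It
-- gives uniqueness of the natural map and reduces `key` in `IsNatural.injective` to generators.
omit [PoissonAlgebra k Z] [PoissonOrder k Z A] in
variable (k Z A) in
theorem adjoin_tensor_symmetricAlgebra_eq_top :
    Algebra.adjoin k (Set.range (fun a : A => (a ⊗ₜ[Z] 1 : A ⊗[Z] SymmetricAlgebra Z (Ω[Z⁄k]))) ∪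
      Set.range (fun z : Z => (1 : A) ⊗ₜ[Z] SymmetricAlgebra.ι Z (Ω[Z⁄k])
        (KaehlerDifferential.D k Z z))) = ⊤ := by
  set S := Algebra.adjoin k (Set.range (fun a : A =>
    (a ⊗ₜ[Z] 1 : A ⊗[Z] SymmetricAlgebra Z (Ω[Z⁄k]))) ∪
      Set.range (fun z : Z => (1 : A) ⊗ₜ[Z] SymmetricAlgebra.ι Z (Ω[Z⁄k])
        (KaehlerDifferential.D k Z z)))
  have hA : ∀ a : A, a ⊗ₜ[Z] 1 ∈ S := fun a => Algebra.subset_adjoin (Or.inl ⟨a, rfl⟩)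
  have hι : ∀ x : Ω[Z⁄k], (1 : A) ⊗ₜ[Z] SymmetricAlgebra.ι Z (Ω[Z⁄k]) x ∈ S := by
    intro x
    have hx : x ∈ Submodule.span Z (Set.range (KaehlerDifferential.D k Z)) := by
      rw [KaehlerDifferential.span_range_derivation]; trivial
    induction hx using Submodule.span_induction with
    | mem x h => obtain ⟨z, rfl⟩ := h; exact Algebra.subset_adjoin (Or.inr ⟨z, rfl⟩)
    | zero => rw [map_zero, TensorProduct.tmul_zero]; exact zero_mem S
    | add x y _ _ hx hy => rw [map_add, TensorProduct.tmul_add]; exact add_mem hx hy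
    | smul c x _ hx =>
      have h := mul_mem (hA (c • 1)) hx
      rwa [Algebra.TensorProduct.tmul_mul_tmul, one_mul, mul_one, TensorProduct.smul_tmul,
        ← map_smul] at h
  refine eq_top_iff.2 fun t ht => ?_
  clear ht
  induction t with
  | zero => exact zero_mem S
  | add s t hs ht => exact add_mem hs ht
  | tmul a s =>
    have hs : (1 : A) ⊗ₜ[Z] s ∈ S := by
      induction s using SymmetricAlgebra.induction with
      | algebraMap c =>
        rw [Algebra.algebraMap_eq_smul_one, ← TensorProduct.smul_tmul]; exact hA _
      | ι x => exact hι x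
      | mul x y hx hy =>
        have h := mul_mem hx hy
        rwa [Algebra.TensorProduct.tmul_mul_tmul, one_mul] at h
      | add x y hx hy => rw [TensorProduct.tmul_add]; exact add_mem hx hy
    have h := mul_mem (hA a) hs
    rwa [Algebra.TensorProduct.tmul_mul_tmul, one_mul, mul_one] at h

theorem IsNatural.eq
    {φ ψ : A ⊗[Z] SymmetricAlgebra Z (Ω[Z⁄k]) →ₐ[k] Gr (filt k Z A)}
    (hφ : IsNatural k Z A φ) (hψ : IsNatural k Z A ψ) : φ = ψ := by
  refine AlgHom.ext_of_adjoin_eq_top (adjoin_tensor_symmetricAlgebra_eq_top k Z A) ?_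
  rintro _ (⟨a, rfl⟩ | ⟨z, rfl⟩)
  · exact (hφ.1 a).trans (hψ.1 a).symm
  · exact (hφ.2 z).trans (hψ.2 z).symm

theorem IsNatural.surjective
    {φ : A ⊗[Z] SymmetricAlgebra Z (Ω[Z⁄k]) →ₐ[k] Gr (filt k Z A)}
    (hφ : IsNatural k Z A φ) : Function.Surjective φ := by
  rw [← AlgHom.range_eq_top, eq_top_iff, ← adjoin_gr_eq_top, Algebra.adjoin_le_iff]
  rintro _ (⟨a, rfl⟩ | ⟨z, rfl⟩)
  · exact ⟨_, hφ.1 a⟩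
  · exact ⟨_, hφ.2 z⟩

end PoissonEnv


/-! ### Injectivity of the natural homomorphism -/

namespace MvPolynomial

variable {σ R : Type*} [CommRing R]

theorem homogeneousComponent_X_mul (n : ℕ) (i : σ) (p : MvPolynomial σ R) :
    homogeneousComponent (n + 1) (X i * p) = X i * homogeneousComponent n p := by
  classical
  ext d
  rw [coeff_homogeneousComponent, coeff_X_mul', coeff_X_mul', coeff_homogeneousComponent]
  by_cases hi : i ∈ d.support
  · have h : d = Finsupp.single i 1 + (d - Finsupp.single i 1) := by
      rw [add_tsub_cancel_of_le]
      exact Finsupp.single_le_iff.2 (Nat.one_le_iff_ne_zero.2 (Finsupp.mem_support_iff.1 hi))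
    have hd : d.degree = n + 1 ↔ (d - Finsupp.single i 1).degree = n := by
      conv_lhs => rw [h, map_add, Finsupp.degree_single]
      omega
    simp only [hi, if_true, hd]
  · simp [hi]

end MvPolynomial

namespace CotangentFrame

open MvPolynomial

variable {k Z : Type*} [Field k] [CommRing Z] [Algebra k Z] {r : ℕ} (F : CotangentFrame k Z r)

theorem homogeneousComponent_sym_mul (n : ℕ) (x : Z) (p : MvPolynomial (Fin r) Z) :
    homogeneousComponent (n + 1) (F.sym x * p) = F.sym x * homogeneousComponent n p := by
  rw [sym_apply, Finset.sum_mul, map_sum, Finset.sum_mul]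
  refine Finset.sum_congr rfl fun i _ => ?_
  rw [smul_mul_assoc, map_smul, homogeneousComponent_X_mul, smul_mul_assoc]

/-- The embedding of the symmetric algebra of the cotangent module into the polynomial ring. -/
noncomputable def symEmb : SymmetricAlgebra Z (Ω[Z⁄k]) →ₐ[Z] MvPolynomial (Fin r) Z :=
  SymmetricAlgebra.lift F.sym.liftKaehlerDifferential

theorem symEmb_ι_D (x : Z) :
    F.symEmb (SymmetricAlgebra.ι Z _ (KaehlerDifferential.D k Z x)) = F.sym x := by
  rw [symEmb, SymmetricAlgebra.lift_ι_apply, Derivation.liftKaehlerDifferential_comp_D]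

/-- The retraction of the polynomial ring onto the symmetric algebra of the cotangent module. -/
noncomputable def symRetract : MvPolynomial (Fin r) Z →ₐ[Z] SymmetricAlgebra Z (Ω[Z⁄k]) :=
  aeval fun i => SymmetricAlgebra.ι Z _ (KaehlerDifferential.D k Z (F.elt i))

theorem symRetract_symEmb (s : SymmetricAlgebra Z (Ω[Z⁄k])) : F.symRetract (F.symEmb s) = s := by
  have h : F.symRetract.comp F.symEmb = AlgHom.id Z _ := by
    refine SymmetricAlgebra.algHom_ext ?_
    refine Derivation.liftKaehlerDifferential_unique _ _ ?_
    ext x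
    change F.symRetract (F.symEmb (SymmetricAlgebra.ι Z _ (KaehlerDifferential.D k Z x))) =
      SymmetricAlgebra.ι Z _ (KaehlerDifferential.D k Z x)
    rw [symEmb_ι_D, sym_apply, F.D_eq x]
    simp [symRetract]
  exact DFunLike.congr_fun h s

variable (A : Type*) [Ring A] [Algebra Z A]

/-- The embedding of `A ⊗ S(Ω)` into the polynomials with coefficients in `A`. -/
noncomputable def tensorEmb :
    A ⊗[Z] SymmetricAlgebra Z (Ω[Z⁄k]) →ₐ[Z] A ⊗[Z] MvPolynomial (Fin r) Z :=
  Algebra.TensorProduct.map (AlgHom.id Z A) F.symEmb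

/-- `symEmb` is split by `symRetract`, and a split injection stays injective after tensoring, with
no flatness of `A`. -/
theorem tensorEmb_injective : Function.Injective (F.tensorEmb A) := by
  have h : ∀ t, Algebra.TensorProduct.map (AlgHom.id Z A) F.symRetract (F.tensorEmb A t) = t := by
    intro t
    induction t with
    | zero => simp
    | tmul a s => simp [tensorEmb, symRetract_symEmb]
    | add s t hs ht => rw [map_add, map_add, hs, ht]
  exact fun s t hst => by rw [← h s, hst, h]

/-- The component of degree `n` of an element of `A ⊗ S(Ω)`. -/
noncomputable def component (n : ℕ) : A ⊗[Z] F.fixed →ₗ[Z] A ⊗[Z] MvPolynomial (Fin r) Z :=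
  LinearMap.lTensor A ((homogeneousComponent n).comp F.fixed.subtype)

variable {A} in
theorem component_tmul (n : ℕ) (a : A) (p : F.fixed) :
    F.component A n (a ⊗ₜ p) = a ⊗ₜ homogeneousComponent n (p : MvPolynomial (Fin r) Z) := rfl

/-- The elements of degree at most `n` of `A ⊗ S(Ω)`. -/
noncomputable def degreeLE (n : ℕ) : AddSubgroup (A ⊗[Z] F.fixed) :=
  AddSubgroup.closure
    {t | ∃ (a : A) (p : F.fixed), (p : MvPolynomial (Fin r) Z).totalDegree ≤ n ∧ t = a ⊗ₜ p}

variable {A}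

theorem tmul_mem_degreeLE {n : ℕ} (a : A) {p : F.fixed}
    (hp : (p : MvPolynomial (Fin r) Z).totalDegree ≤ n) : a ⊗ₜ p ∈ F.degreeLE A n :=
  AddSubgroup.subset_closure ⟨a, p, hp, rfl⟩

theorem degreeLE_mono {m n : ℕ} (h : m ≤ n) : F.degreeLE A m ≤ F.degreeLE A n :=
  AddSubgroup.closure_mono fun _ ⟨a, p, hp, e⟩ => ⟨a, p, hp.trans h, e⟩

theorem smul_mem_degreeLE {n : ℕ} (a : A) {t : A ⊗[Z] F.fixed} (ht : t ∈ F.degreeLE A n) :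
    a • t ∈ F.degreeLE A n := by
  induction ht using AddSubgroup.closure_induction with
  | mem t h =>
    obtain ⟨b, p, hp, rfl⟩ := h
    exact F.tmul_mem_degreeLE _ hp
  | zero => rw [smul_zero]; exact zero_mem _
  | add s t _ _ hs ht => rw [smul_add]; exact add_mem hs ht
  | neg t _ ht => rw [smul_neg]; exact neg_mem ht

theorem component_eq_zero {m n : ℕ} (h : m < n) {t : A ⊗[Z] F.fixed} (ht : t ∈ F.degreeLE A m) :
    F.component A n t = 0 := by
  induction ht using AddSubgroup.closure_induction with
  | mem t ht =>
    obtain ⟨b, p, hp, rfl⟩ := ht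
    rw [component_tmul, homogeneousComponent_eq_zero _ _ (hp.trans_lt h), TensorProduct.tmul_zero]
  | zero => rw [map_zero]
  | add s t _ _ hs ht => rw [map_add, hs, ht, add_zero]
  | neg t _ ht => rw [map_neg, ht, neg_zero]

theorem component_smul (n : ℕ) (a : A) (t : A ⊗[Z] F.fixed) :
    F.component A n (a • t) = (a ⊗ₜ[Z] (1 : MvPolynomial (Fin r) Z)) * F.component A n t := by
  induction t with
  | zero => simp
  | tmul b p => rw [TensorProduct.smul_tmul', component_tmul, component_tmul,
      Algebra.TensorProduct.tmul_mul_tmul, one_mul, smul_eq_mul]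
  | add s t hs ht => rw [smul_add, map_add, hs, ht, map_add, mul_add]

section

variable [PoissonAlgebra k Z] [Algebra k A] [IsScalarTower k Z A] [PoissonOrder k Z A]
  {F} {e : HamiltonianAction k Z F.fixed}
  (he : ∀ x (p : F.fixed), ((e.op x p : MvPolynomial (Fin r) Z) - F.sym x * p).totalDegree
      ≤ (p : MvPolynomial (Fin r) Z).totalDegree)
include he

theorem tensorOp_mem_degreeLE {n : ℕ} (x : Z) {t : A ⊗[Z] F.fixed} (ht : t ∈ F.degreeLE A n) :
    e.tensorOp A x t ∈ F.degreeLE A (n + 1) := by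
  induction ht using AddSubgroup.closure_induction with
  | mem t h =>
    obtain ⟨b, p, hp, rfl⟩ := h
    rw [HamiltonianAction.tensorOp_tmul]
    refine add_mem (F.tmul_mem_degreeLE _ (hp.trans n.le_succ)) (F.tmul_mem_degreeLE _ ?_)
    rw [← sub_add_cancel (e.op x p : MvPolynomial (Fin r) Z) (F.sym x * p)]
    exact (totalDegree_add _ _).trans (max_le (((he x p).trans hp).trans n.le_succ)
      ((F.totalDegree_sym_mul_le x p).trans (Nat.succ_le_succ hp)))
  | zero => rw [map_zero]; exact zero_mem _
  | add s t _ _ hs ht => rw [map_add]; exact add_mem hs ht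
  | neg t _ ht => rw [map_neg]; exact neg_mem ht

/-- The principal symbol of `δ x` is multiplication by `dx`: the term with `{x, b}` and the error
allowed by `he` both have degree at most `n`. -/
theorem component_tensorOp {n : ℕ} (x : Z) {t : A ⊗[Z] F.fixed} (ht : t ∈ F.degreeLE A n) :
    F.component A (n + 1) (e.tensorOp A x t) = ((1 : A) ⊗ₜ[Z] F.sym x) * F.component A n t := by
  induction ht using AddSubgroup.closure_induction with
  | mem t h =>
    obtain ⟨b, p, hp, rfl⟩ := h
    rw [HamiltonianAction.tensorOp_tmul, map_add, component_tmul, component_tmul, component_tmul,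
      homogeneousComponent_eq_zero _ _ (Nat.lt_succ_of_le hp), TensorProduct.tmul_zero, zero_add,
      ← sub_add_cancel (e.op x p : MvPolynomial (Fin r) Z) (F.sym x * p), map_add,
      homogeneousComponent_eq_zero _ _ (Nat.lt_succ_of_le ((he x p).trans hp)), zero_add,
      homogeneousComponent_sym_mul, Algebra.TensorProduct.tmul_mul_tmul, one_mul]
  | zero => simp
  | add s t _ _ hs ht => rw [map_add, map_add, hs, ht, map_add, mul_add]
  | neg t _ ht =>
    rw [map_neg, map_neg, ht, map_neg, neg_eq_iff_add_eq_zero, ← mul_add, add_neg_cancel, mul_zero]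

end

end CotangentFrame

namespace PoissonEnv

open FilteredAlgebra MvPolynomial

variable {k Z A : Type*} [Field k] [CommRing Z] [Algebra k Z] [PoissonAlgebra k Z]
  [Ring A] [Algebra k A] [Algebra Z A] [IsScalarTower k Z A] [PoissonOrder k Z A]

/-- Taking the degree `n` component of `w (1 ⊗ 1)` for `w` of filtration degree `n` defines `θ` on
the graded algebra, and `θ ∘ φ` is the injective map `tensorEmb`. -/
theorem IsNatural.injective (hLie : ∀ (x y : Z) (a : A),
      PoissonOrder.ham (k := k) (PoissonAlgebra.bracket (k := k) x y) a =
        PoissonOrder.ham (k := k) x (PoissonOrder.ham (k := k) y a)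
          - PoissonOrder.ham (k := k) y (PoissonOrder.ham (k := k) x a))
    {r : ℕ} (F : CotangentFrame k Z r)
    {φ : A ⊗[Z] SymmetricAlgebra Z (Ω[Z⁄k]) →ₐ[k] Gr (filt k Z A)}
    (hφ : IsNatural k Z A φ) : Function.Injective φ := by
  obtain ⟨e, he⟩ := F.exists_hamiltonianAction k
  let u : A ⊗[Z] F.fixed := 1 ⊗ₜ ⟨1, map_one F.proj⟩
  let ρ := e.rep A hLie
  have hα : ∀ a w, ρ (alpha k Z A a * w) u = a • ρ w u := fun a w => by
    rw [map_mul, Module.End.mul_apply, HamiltonianAction.rep_alpha]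
  have hδ : ∀ x w, ρ (delta k Z A x * w) u = e.tensorOp A x (ρ w u) := fun x w => by
    rw [map_mul, Module.End.mul_apply, HamiltonianAction.rep_delta]
  have hlist : ∀ l : List (A ⊕ Z),
      ρ (l.map (gen k Z A)).prod u ∈ F.degreeLE A (l.countP Sum.isRight) := by
    intro l
    induction l with
    | nil =>
      rw [List.map_nil, List.prod_nil, map_one]
      exact F.tmul_mem_degreeLE _ totalDegree_one.le
    | cons s l ih =>
      rw [List.map_cons, List.prod_cons]
      rcases s with a | x
      · rw [gen_inl, hα, List.countP_cons]
        exact F.smul_mem_degreeLE a ih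
      · rw [gen_inr, hδ, List.countP_cons]
        exact CotangentFrame.tensorOp_mem_degreeLE he x ih
  have hfilt : ∀ n w, w ∈ filt k Z A n → ρ w u ∈ F.degreeLE A n := by
    intro n w hw
    change w ∈ Submodule.span k _ at hw
    induction hw using Submodule.span_induction with
    | mem w h =>
      obtain ⟨l, hl, rfl⟩ := h
      exact F.degreeLE_mono hl (hlist l)
    | zero => rw [map_zero]; exact zero_mem _
    | add x y _ _ hx hy => rw [map_add]; exact add_mem hx hy
    | smul c x _ hx =>
      rw [map_smul, LinearMap.smul_apply, ← algebraMap_smul A c]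
      exact F.smul_mem_degreeLE _ hx
  let θ' (n : ℕ) : Piece (filt k Z A) n →+ A ⊗[Z] MvPolynomial (Fin r) Z :=
    QuotientAddGroup.lift ((lt (filt k Z A) n).submoduleOf (filt k Z A n)).toAddSubgroup
      { toFun := fun w => F.component A n (ρ w.1 u)
        map_zero' := by simp
        map_add' := fun v w => by simp }
      (fun w hw => by
        have hw' : (w : PoissonEnv k Z A) ∈ lt (filt k Z A) n := hw
        cases n with
        | zero =>
          have h0 : (w : PoissonEnv k Z A) = 0 := by simpa [lt] using hw'
          change F.component A 0 (ρ w.1 u) = 0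
          rw [h0]; simp
        | succ n => exact F.component_eq_zero n.lt_succ_self (hfilt n _ hw'))
  let θ : Gr (filt k Z A) →+ A ⊗[Z] MvPolynomial (Fin r) Z := DirectSum.toAddMonoid θ'
  have hθ : ∀ n w hw, θ (symb (filt k Z A) n w hw) = F.component A n (ρ w u) := fun n w hw =>
    DirectSum.toAddMonoid_of θ' n (cls (filt k Z A) w hw)
  -- `θ` is only additive; quantifying over `g` gives a statement stable under products of `t`, so
  -- generators suffice. The claim for `φ` follows at `g = 1`.
  have key : ∀ t g, θ (φ t * g) = F.tensorEmb A t * θ g := by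
    intro t
    have ht : t ∈ (⊤ : Subalgebra k (A ⊗[Z] SymmetricAlgebra Z (Ω[Z⁄k]))) := trivial
    rw [← adjoin_tensor_symmetricAlgebra_eq_top k Z A] at ht
    induction ht using Algebra.adjoin_induction with
    | mem t h =>
      intro g
      rcases h with ⟨a, rfl⟩ | ⟨x, rfl⟩
      · have hJ : F.tensorEmb A (a ⊗ₜ 1) = a ⊗ₜ 1 := by simp [CotangentFrame.tensorEmb]
        rw [hφ.1, hJ]
        induction g using symb_induction with
        | zero => simp
        | add g h hg hh => rw [mul_add, map_add, hg, hh, map_add, mul_add]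
        | symb i w hw => rw [symb_mul, hθ, hθ, hα, zero_add, F.component_smul]
      · have hJ : F.tensorEmb A (1 ⊗ₜ SymmetricAlgebra.ι Z _ (KaehlerDifferential.D k Z x)) =
            1 ⊗ₜ F.sym x := by
          simp [CotangentFrame.tensorEmb, CotangentFrame.symEmb_ι_D]
        rw [hφ.2, hJ]
        induction g using symb_induction with
        | zero => simp
        | add g h hg hh => rw [mul_add, map_add, hg, hh, map_add, mul_add]
        | symb i w hw =>
          rw [symb_mul, hθ, hθ, hδ, add_comm 1 i, CotangentFrame.component_tensorOp he x
            (hfilt i w hw)]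
    | algebraMap c =>
      intro g
      have hA : algebraMap k (A ⊗[Z] SymmetricAlgebra Z (Ω[Z⁄k])) c
          = algebraMap k A c ⊗ₜ 1 := rfl
      have hJ : F.tensorEmb A (algebraMap k A c ⊗ₜ 1) = algebraMap k A c ⊗ₜ 1 := by
        simp [CotangentFrame.tensorEmb]
      rw [hA, hφ.1, hJ]
      induction g using symb_induction with
      | zero => simp
      | add g h hg hh => rw [mul_add, map_add, hg, hh, map_add, mul_add]
      | symb i w hw => rw [symb_mul, hθ, hθ, hα, zero_add, F.component_smul]
    | add s t _ _ hs ht =>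
      intro g; rw [map_add, add_mul, map_add, hs, ht, map_add, add_mul]
    | mul s t _ _ hs ht =>
      intro g; rw [map_mul φ, mul_assoc, hs, ht, map_mul (F.tensorEmb A), mul_assoc]
  have h1 : θ 1 = 1 := by
    rw [← symb_one, hθ, map_one, Module.End.one_apply, F.component_tmul,
      homogeneousComponent_eq_self]
    · rfl
    · exact isHomogeneous_one _ _
  intro s t hst
  refine F.tensorEmb_injective A ?_
  have hs := key s 1
  have ht := key t 1
  rw [mul_one, h1, mul_one] at hs ht
  rw [← hs, ← ht, hst]

end PoissonEnv


/-! ### Regular local rings are domains -/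

section

open IsLocalRing
-- Exchange argument: as `x` lies outside the square of the maximal ideal, some coefficient of `x`
-- on the generators is a unit, and that generator can be traded for `x`.
theorem IsLocalRing.sup_span_erase_eq_maximalIdeal {R : Type*} [CommRing R] [IsLocalRing R]
    [DecidableEq R] {s : Finset R} (hs : Ideal.span (s : Set R) = maximalIdeal R) {x : R}
    (hx : x ∈ maximalIdeal R) (hx2 : x ∉ maximalIdeal R ^ 2) :
    ∃ g ∈ s, maximalIdeal R = Ideal.span {x} ⊔ Ideal.span (s.erase g : Set R) := by
  have hx' := hx
  rw [← hs, Ideal.span, Submodule.mem_span_finset] at hx'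
  obtain ⟨a, -, rfl⟩ := hx'
  have hsm : ∀ g ∈ s, g ∈ maximalIdeal R := fun g hg => hs ▸ Ideal.subset_span hg
  obtain ⟨g, hg, hag⟩ : ∃ g ∈ s, IsUnit (a g) := by
    by_contra! h
    refine hx2 (Ideal.sum_mem _ fun g hg => ?_)
    rw [pow_two]
    exact Ideal.mul_mem_mul ((mem_maximalIdeal _).2 (h g hg)) (hsm g hg)
  refine ⟨g, hg, le_antisymm ?_ (sup_le ?_ ?_)⟩
  · rw [← hs, Ideal.span_le]
    intro y hy
    by_cases hyg : y = g
    · subst hyg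
      obtain ⟨u, hu⟩ := hag
      have h1 : (a y) * y = (∑ g ∈ s, a g • g) - ∑ g ∈ s.erase y, a g • g := by
        rw [← Finset.add_sum_erase _ _ hg, smul_eq_mul]; ring
      have h2 : a y * y ∈ Ideal.span {∑ g ∈ s, a g • g} ⊔ Ideal.span (s.erase y : Set R) := by
        rw [h1]
        refine sub_mem (Ideal.mem_sup_left (Ideal.mem_span_singleton_self _))
          (Ideal.mem_sup_right (Ideal.sum_mem _ fun i hi => ?_))
        exact Ideal.mul_mem_left _ _ (Ideal.subset_span hi)
      have := Ideal.mul_mem_left _ (↑u⁻¹ : R) h2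
      rwa [← hu, Units.inv_mul_cancel_left] at this
    · exact Ideal.mem_sup_right (Ideal.subset_span (Finset.mem_coe.2 (Finset.mem_erase.2 ⟨hyg, hy⟩)))
  · rwa [Ideal.span_singleton_le_iff_mem]
  · rw [Ideal.span_le]
    exact fun y hy => hsm y (Finset.mem_of_mem_erase hy)

/-- Modulo `x` the number of generators of the maximal ideal drops by at least one, by exchange, and
the Krull dimension by at most one. -/
theorem IsRegularLocalRing.exists_quotient {R : Type*} [CommRing R] [IsRegularLocalRing R] {n : ℕ}
    (hn : (maximalIdeal R).spanFinrank = n + 1) {x : R}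
    (hx : x ∈ maximalIdeal R) (hx2 : x ∉ maximalIdeal R ^ 2) :
    ∃ _ : IsRegularLocalRing (R ⧸ Ideal.span {x}),
      (maximalIdeal (R ⧸ Ideal.span {x})).spanFinrank = n := by
  classical
  have hne : Ideal.span {x} ≠ ⊤ := fun h => (maximalIdeal.isMaximal R).ne_top
    (top_le_iff.1 (h ▸ (Ideal.span_singleton_le_iff_mem _).2 hx))
  have : Nontrivial (R ⧸ Ideal.span {x}) := Ideal.Quotient.nontrivial_iff.2 hne
  have : IsLocalRing (R ⧸ Ideal.span {x}) :=
    .of_surjective' (Ideal.Quotient.mk _) Ideal.Quotient.mk_surjective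
  obtain ⟨s, hsc, hs⟩ := Submodule.FG.exists_span_finset_card_eq_spanFinrank
    (IsNoetherian.noetherian (maximalIdeal R))
  obtain ⟨g, hg, hm⟩ := sup_span_erase_eq_maximalIdeal hs hx hx2
  have hmap : maximalIdeal (R ⧸ Ideal.span {x}) =
      Ideal.span ((s.erase g).image (Ideal.Quotient.mk (Ideal.span {x})) : Set _) := by
    rw [Finset.coe_image, ← Ideal.map_span]
    rw [← IsLocalRing.map_maximalIdeal_of_surjective _ (Ideal.Quotient.mk_surjective (I := Ideal.span {x}))]
    conv_lhs => rw [hm]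
    rw [Ideal.map_sup, Ideal.map_quotient_self, bot_sup_eq]
  have hle : (maximalIdeal (R ⧸ Ideal.span {x})).spanFinrank ≤ n := by
    rw [hmap]
    refine (Submodule.spanFinrank_span_le_ncard_of_finite (Finset.finite_toSet _)).trans ?_
    rw [Set.ncard_coe_finset]
    refine Finset.card_image_le.trans ?_
    rw [Finset.card_erase_of_mem hg, hsc, hn, Nat.add_sub_cancel]
  have hdim : (n : WithBot ℕ∞) ≤ ringKrullDim (R ⧸ Ideal.span {x}) := by
    have h := ringKrullDim_le_ringKrullDim_quotient_add_card ({x} : Finset R)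
      (by simpa [IsLocalRing.ringJacobson_eq_maximalIdeal] using hx)
    rw [← IsRegularLocalRing.spanFinrank_maximalIdeal, hn] at h
    rw [Finset.coe_singleton, Finset.card_singleton, Nat.cast_add, Nat.cast_one] at h
    have : Nontrivial (R ⧸ Ideal.span {x}) := inferInstance
    obtain ⟨d, hd⟩ := WithBot.ne_bot_iff_exists.1 (ringKrullDim_ne_bot (R := R ⧸ Ideal.span {x}))
    rw [← hd] at h ⊢
    norm_cast at h ⊢
    exact (ENat.add_le_add_iff_right (ENat.one_ne_top)).1 (by exact_mod_cast h)
  have hreg := IsRegularLocalRing.of_spanFinrank_maximalIdeal_le (R ⧸ Ideal.span {x})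
    (le_trans (by exact_mod_cast hle) hdim)
  refine ⟨hreg, le_antisymm hle ?_⟩
  rw [← IsRegularLocalRing.spanFinrank_maximalIdeal] at hdim
  exact_mod_cast hdim

theorem IsRegularLocalRing.isDomain (R : Type*) [CommRing R] [IsRegularLocalRing R] :
    IsDomain R := by
  obtain ⟨n, hn⟩ : ∃ n, (maximalIdeal R).spanFinrank = n := ⟨_, rfl⟩
  induction n generalizing R with
  | zero =>
    have h := (Submodule.spanFinrank_eq_zero_iff_eq_bot (IsNoetherian.noetherian _)).1 hn
    exact (isField_iff_maximalIdeal_eq.2 h).isDomain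
  | succ n ih =>
    obtain ⟨x, hx, hx2, hxq⟩ : ∃ x ∈ maximalIdeal R, x ∉ maximalIdeal R ^ 2 ∧
        ∀ q ∈ minimalPrimes R, x ∉ q := by
      by_contra! h
      -- Prime avoidance tolerates two ideals that are not prime; the square of the maximal ideal
      -- fills both places.
      have hsub := (Ideal.subset_union_prime_finite (I := maximalIdeal R) (f := id)
        ((minimalPrimes.finite_of_isNoetherianRing R).insert (maximalIdeal R ^ 2))
        (maximalIdeal R ^ 2) (maximalIdeal R ^ 2)
        (fun i hi h1 _ => ((Set.mem_insert_iff.1 hi).resolve_left h1).1.1)).1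
        (fun x hx => by
          by_cases hx2 : x ∈ maximalIdeal R ^ 2
          · exact Set.mem_biUnion (Set.mem_insert _ _) hx2
          · obtain ⟨q, hq, hxq⟩ := h x hx hx2
            exact Set.mem_biUnion (Set.mem_insert_of_mem _ hq) hxq)
      have h0 : ringKrullDim R ≠ 0 := by
        rw [← IsRegularLocalRing.spanFinrank_maximalIdeal, hn]
        exact_mod_cast Nat.succ_ne_zero n
      obtain ⟨i, hi, hle⟩ := hsub
      rcases Set.mem_insert_iff.1 hi with rfl | hi
      · have hbot : maximalIdeal R = ⊥ := by
          refine Submodule.eq_bot_of_le_smul_of_le_jacobson_bot (maximalIdeal R) _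
            (IsNoetherian.noetherian _) ?_ (IsLocalRing.maximalIdeal_le_jacobson _)
          rw [smul_eq_mul, ← pow_two]
          exact hle
        rw [hbot, Submodule.spanFinrank_bot] at hn
        simp at hn
      · have := hi.1.1
        have him : i = maximalIdeal R := le_antisymm (le_maximalIdeal this.ne_top) hle
        rw [← IsLocalRing.maximalIdeal_height_eq_ringKrullDim, ← him,
          Ideal.height_eq_zero_iff.2 hi] at h0
        exact h0 rfl
    obtain ⟨hreg, hrk⟩ := exists_quotient hn hx hx2
    have hdom := ih _ hrk
    have hp : (Ideal.span {x}).IsPrime := (Ideal.Quotient.isDomain_iff_prime _).1 hdom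
    obtain ⟨q, hq, hqx⟩ := Ideal.exists_minimalPrimes_le (bot_le : ⊥ ≤ Ideal.span {x})
    have := hq.1.1
    -- Elements of `q` are multiples of `x`, and `x` is not in the prime `q`, so `q = x q` and
    -- Nakayama applies.
    have hqbot : q = ⊥ := by
      refine Submodule.eq_bot_of_le_smul_of_le_jacobson_bot (maximalIdeal R) _
        (IsNoetherian.noetherian _) ?_ (IsLocalRing.maximalIdeal_le_jacobson _)
      intro y hy
      obtain ⟨c, rfl⟩ := Ideal.mem_span_singleton'.1 (hqx hy)
      rw [smul_eq_mul, mul_comm c]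
      exact Ideal.mul_mem_mul hx ((this.mem_or_mem hy).resolve_right (hxq q hq))
    subst hqbot
    exact IsDomain.of_bot_isPrime R

end


/-! ### Dimension, transcendence degree and differentials -/

/-- Noether normalisation of the image of `Z` in `R`: strict inclusions of primes of `R` stay strict
in the polynomial ring, by clearing denominators and incomparability for integral extensions. -/
theorem exists_algebraicIndependent_of_isLocalization_atPrime (k Z R : Type*) [Field k]
    [CommRing Z] [Algebra k Z] [Algebra.FiniteType k Z] [CommRing R] [Nontrivial R] [Algebra k R]
    [Algebra Z R] [IsScalarTower k Z R] (M : Submonoid Z) [IsLocalization M R] :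
    ∃ (s : ℕ) (x : Fin s → R), AlgebraicIndependent k x ∧ ringKrullDim R ≤ s := by
  let B := (IsScalarTower.toAlgHom k Z R).range
  have : Algebra.FiniteType k B :=
    .of_surjective (IsScalarTower.toAlgHom k Z R).rangeRestrict
      (AlgHom.rangeRestrict_surjective _)
  obtain ⟨s, g, hinj, hint⟩ := exists_integral_inj_algHom_of_fg k B
  have hind : AlgebraicIndependent k fun i => B.val (g (MvPolynomial.X i)) := by
    have : MvPolynomial.aeval (fun i => B.val (g (MvPolynomial.X i))) = B.val.comp g := by
      ext i; simp
    rw [AlgebraicIndependent, this]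
    exact Subtype.val_injective.comp hinj
  refine ⟨s, _, hind, ?_⟩
  have hdim : ringKrullDim (MvPolynomial (Fin s) k) = s := by
    simp
  rw [← hdim]
  refine Order.krullDim_le_of_strictMono (PrimeSpectrum.comap (B.val.comp g).toRingHom) ?_
  intro p q hpq
  have hle : p.asIdeal ≤ q.asIdeal := hpq.le
  obtain ⟨y, hyq, hyp⟩ := Set.exists_of_ssubset (show (p.asIdeal : Set R) ⊂ q.asIdeal from hpq)
  obtain ⟨⟨z, t⟩, hz⟩ := IsLocalization.surj M y
  have hzq : algebraMap Z R z ∈ q.asIdeal := by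
    rw [← hz]; exact Ideal.mul_mem_right _ _ hyq
  have hzp : algebraMap Z R z ∉ p.asIdeal := by
    rw [← hz]
    intro h
    rcases p.2.mem_or_mem h with h | h
    · exact hyp h
    · exact p.2.ne_top (Ideal.eq_top_of_isUnit_mem _ h (IsLocalization.map_units R t))
  algebraize [g.toRingHom]
  have := Ideal.comap_lt_comap_of_integral_mem_sdiff (R := MvPolynomial (Fin s) k)
    (I := p.asIdeal.comap B.val) (J := q.asIdeal.comap B.val) (Ideal.comap_mono hle)
    (x := (IsScalarTower.toAlgHom k Z R).rangeRestrict z) ⟨hzq, hzp⟩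
    (hint _)
  exact this


/-- If the `dt` span, then `K` has no differentials over the field generated by `t`, so it is
unramified and hence separable algebraic over it. No assumption on the characteristic enters. -/
theorem KaehlerDifferential.isAlgebraic_adjoin_of_span_eq_top {k K : Type*} [Field k] [Field K]
    [Algebra k K] [Algebra.EssFiniteType k K] {t : Set K}
    (ht : Submodule.span K (KaehlerDifferential.D k K '' t) = ⊤) :
    Algebra.IsAlgebraic (Algebra.adjoin k t) K := by
  rw [← IntermediateField.isAlgebraic_adjoin_iff_top]
  set E := IntermediateField.adjoin k t
  have : Algebra.EssFiniteType E K := .of_comp k E K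
  have hzero : KaehlerDifferential.map k E K K = 0 := by
    refine LinearMap.ext_on ht ?_
    rintro _ ⟨y, hy, rfl⟩
    rw [KaehlerDifferential.map_D]
    exact (KaehlerDifferential.D E K).map_algebraMap
      (⟨y, IntermediateField.subset_adjoin k t hy⟩ : E)
  have : Algebra.FormallyUnramified E K := by
    refine ⟨⟨fun a b => ?_⟩⟩
    obtain ⟨a, rfl⟩ := KaehlerDifferential.map_surjective k E K a
    obtain ⟨b, rfl⟩ := KaehlerDifferential.map_surjective k E K b
    rw [hzero]; rfl
  have := Algebra.FormallyUnramified.isSeparable E K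
  infer_instance

theorem AlgebraicIndependent.card_le_finrank_kaehlerDifferential {k K : Type*} [Field k] [Field K]
    [Algebra k K] [Algebra.EssFiniteType k K] {s : ℕ} {x : Fin s → K}
    (hx : AlgebraicIndependent k x) : s ≤ Module.finrank K (Ω[K⁄k]) := by
  obtain ⟨b, hb, hspan, hli⟩ := exists_linearIndependent K (Set.range (KaehlerDifferential.D k K))
  rw [KaehlerDifferential.span_range_derivation] at hspan
  choose y hy using fun v : b => hb v.2
  have hyb : KaehlerDifferential.D k K '' Set.range y = b := by
    rw [← Set.range_comp]
    simp [Function.comp_def, hy]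
  have := KaehlerDifferential.isAlgebraic_adjoin_of_span_eq_top (t := Set.range y)
    (hyb ▸ hspan)
  have hfin : Finite b := hli.finite
  have := hx.lift_cardinalMk_le_trdeg.trans (Cardinal.lift_le.2
    ((Algebra.IsAlgebraic.trdeg_le_cardinalMk k (Set.range y)).trans Cardinal.mk_range_le))
  rw [Module.finrank_eq_nat_card_basis
    (Module.Basis.mk hli (by rw [Subtype.range_coe]; exact hspan.ge))]
  rw [← Nat.cast_card (α := b)] at this
  simpa using this


/-- Nakayama: subtracting a constant puts any element in the maximal ideal without changing its
differential, and in `d(a y) = a dy + y da` the last term is zero modulo the maximal ideal. -/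
theorem IsLocalRing.span_D_eq_top {k R ι : Type*} [Field k] [CommRing R] [IsLocalRing R]
    [Algebra k R] [Algebra.EssFiniteType k R]
    (hk : ∀ r : R, ∃ c : k, r - algebraMap k R c ∈ IsLocalRing.maximalIdeal R) {x : ι → R}
    (hx : Ideal.span (Set.range x) = IsLocalRing.maximalIdeal R) :
    Submodule.span R (Set.range fun i => KaehlerDifferential.D k R (x i)) = ⊤ := by
  refine top_le_iff.1 (Submodule.le_of_le_smul_of_le_jacobson_bot (I := IsLocalRing.maximalIdeal R)
    (Module.Finite.fg_top) (IsLocalRing.maximalIdeal_le_jacobson _) ?_)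
  have key : ∀ y ∈ IsLocalRing.maximalIdeal R, KaehlerDifferential.D k R y ∈
      Submodule.span R (Set.range fun i => KaehlerDifferential.D k R (x i)) ⊔
        IsLocalRing.maximalIdeal R • (⊤ : Submodule R (Ω[R⁄k])) := by
    intro y hy
    rw [← hx] at hy
    induction hy using Submodule.span_induction with
    | mem y hy =>
      obtain ⟨i, rfl⟩ := hy
      exact Submodule.mem_sup_left (Submodule.subset_span ⟨i, rfl⟩)
    | zero => simp
    | add y z _ _ h1 h2 => rw [map_add]; exact add_mem h1 h2
    | smul a y hy h =>
      rw [smul_eq_mul, Derivation.leibniz]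
      refine add_mem (Submodule.smul_mem _ _ h) (Submodule.mem_sup_right ?_)
      exact Submodule.smul_mem_smul (hx ▸ hy) Submodule.mem_top
  conv_lhs => rw [← KaehlerDifferential.span_range_derivation]
  rw [Submodule.span_le]
  rintro _ ⟨r, rfl⟩
  obtain ⟨c, hc⟩ := hk r
  have := key _ hc
  rwa [map_sub, Derivation.map_algebraMap, sub_zero] at this

theorem Ideal.IsMaximal.exists_sub_algebraMap_mem {k Z : Type*} [Field k] [IsAlgClosed k]
    [CommRing Z] [Algebra k Z] [Algebra.FiniteType k Z] {m : Ideal Z} (hm : m.IsMaximal) (z : Z) :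
    ∃ c : k, z - algebraMap k Z c ∈ m := by
  let := Ideal.Quotient.field m
  have : Module.Finite k (Z ⧸ m) := finite_of_finite_type_of_isJacobsonRing k (Z ⧸ m)
  obtain ⟨c, hc⟩ := (IsAlgClosed.algebraMap_bijective_of_isIntegral (k := k) (K := Z ⧸ m)).2
    (Ideal.Quotient.mk m z)
  exact ⟨c, Ideal.Quotient.eq.1 hc.symm⟩

theorem IsLocalization.AtPrime.exists_sub_algebraMap_mem_maximalIdeal {k Z : Type*} [Field k]
    [IsAlgClosed k] [CommRing Z] [Algebra k Z] [Algebra.FiniteType k Z] (m : Ideal Z)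
    [hm : m.IsMaximal] (r : Localization.AtPrime m) :
    ∃ c : k, r - algebraMap k _ c ∈ IsLocalRing.maximalIdeal (Localization.AtPrime m) := by
  obtain ⟨z, hz⟩ := (IsLocalization.AtPrime.equivQuotMaximalIdeal m
    (Localization.AtPrime m)).surjective (Ideal.Quotient.mk _ r)
  obtain ⟨z, rfl⟩ := Ideal.Quotient.mk_surjective z
  obtain ⟨c, hc⟩ := hm.exists_sub_algebraMap_mem (k := k) z
  refine ⟨c, ?_⟩
  rw [IsLocalization.AtPrime.equivQuotMaximalIdeal_apply_mk, Ideal.Quotient.eq] at hz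
  have h2 : algebraMap Z (Localization.AtPrime m) (z - algebraMap k Z c) ∈
      IsLocalRing.maximalIdeal (Localization.AtPrime m) :=
    (IsLocalization.AtPrime.to_map_mem_maximal_iff _ m _).2 hc
  rw [map_sub, ← IsScalarTower.algebraMap_apply] at h2
  have := sub_mem h2 hz
  rwa [sub_sub_sub_cancel_left] at this


/-! ### Projectivity of the differentials and the theorem -/

theorem KaehlerDifferential.free_localization_atPrime (k : Type*) {Z : Type*} [Field k]
    [IsAlgClosed k] [CommRing Z] [Algebra k Z] [Algebra.FiniteType k Z] (m : Ideal Z)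
    [m.IsMaximal] [IsRegularLocalRing (Localization.AtPrime m)] :
    Module.Free (Localization.AtPrime m) (Ω[Localization.AtPrime m⁄k]) := by
  let R := Localization.AtPrime m
  let K := FractionRing R
  have : IsDomain R := IsRegularLocalRing.isDomain R
  have : Algebra.EssFiniteType k K := .comp k R K
  obtain ⟨t, htc, ht⟩ := Submodule.FG.exists_span_finset_card_eq_spanFinrank
    (IsNoetherian.noetherian (IsLocalRing.maximalIdeal R))
  let x : t → R := Subtype.val
  have hspan : Submodule.span R (Set.range fun i => KaehlerDifferential.D k R (x i)) = ⊤ :=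
    IsLocalRing.span_D_eq_top
      (IsLocalization.AtPrime.exists_sub_algebraMap_mem_maximalIdeal m)
      (by rw [← ht]; simp only [x, Subtype.range_coe_subtype]; rfl)
  obtain ⟨s, y, hy, hdim⟩ :=
    exists_algebraicIndependent_of_isLocalization_atPrime k Z R m.primeCompl
  -- By regularity the number of generators is the dimension of `R`, which is bounded by the size of
  -- an algebraically independent family. Hence the spanning differentials are independent over `K`,
  -- and so over `R`.
  have hle : Fintype.card t ≤ Module.finrank K (Ω[K⁄k]) := by
    have h1 : Fintype.card t ≤ s := by
      rw [← IsRegularLocalRing.spanFinrank_maximalIdeal, ← htc] at hdim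
      rw [Fintype.card_coe]
      exact_mod_cast hdim
    refine h1.trans (AlgebraicIndependent.card_le_finrank_kaehlerDifferential
      (x := fun i => algebraMap R K (y i)) ?_)
    exact hy.map' (f := IsScalarTower.toAlgHom k R K) (IsFractionRing.injective R K)
  have hspanK := span_eq_top_of_isLocalizedModule K (nonZeroDivisors R)
    (KaehlerDifferential.map k k R K) hspan
  rw [← Set.range_comp] at hspanK
  have hliK := linearIndependent_of_top_le_span_of_card_le_finrank hspanK.ge hle
  have hli : LinearIndependent R fun i => KaehlerDifferential.D k R (x i) :=
    LinearIndependent.of_comp (KaehlerDifferential.map k k R K) (hliK.restrict_scalars' R)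
  exact Module.Free.of_basis (Module.Basis.mk hli hspan.ge)

instance KaehlerDifferential.projective_of_isRegularRing (k Z : Type*) [Field k] [IsAlgClosed k]
    [CommRing Z] [Algebra k Z] [Algebra.FiniteType k Z] [IsRegularRing Z] :
    Module.Projective Z (Ω[Z⁄k]) := by
  have : Module.FinitePresentation Z (Ω[Z⁄k]) := Module.finitePresentation_of_finite Z _
  refine Module.projective_of_localization_maximal'
    (fun (P : Ideal Z) [P.IsMaximal] => Localization.AtPrime P)
    (fun (P : Ideal Z) [P.IsMaximal] => Ω[Localization.AtPrime P⁄k])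
    (fun (P : Ideal Z) [P.IsMaximal] => KaehlerDifferential.map k k Z (Localization.AtPrime P))
    (inst := fun (P : Ideal Z) [P.IsMaximal] =>
      KaehlerDifferential.isLocalizedModule_map k Z (Localization.AtPrime P) P.primeCompl)
    (fun I hI => ?_)
  have := KaehlerDifferential.free_localization_atPrime k I
  infer_instance

/-- If the module of differentials is finite and projective, it has a cotangent frame. -/
theorem CotangentFrame.nonempty_of_projective (k Z : Type*) [Field k] [CommRing Z] [Algebra k Z]
    [Module.Finite Z (Ω[Z⁄k])] [Module.Projective Z (Ω[Z⁄k])] :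
    ∃ r, Nonempty (CotangentFrame k Z r) := by
  obtain ⟨s, hs, hspan⟩ := Submodule.fg_span_iff_fg_span_finset_subset
    (Set.range (KaehlerDifferential.D k Z)) |>.1
    (by rw [KaehlerDifferential.span_range_derivation]; exact Module.Finite.fg_top)
  rw [KaehlerDifferential.span_range_derivation] at hspan
  choose y hy using fun i : Fin s.card => hs (s.equivFin.symm i).2
  have hrange : Set.range (fun i => KaehlerDifferential.D k Z (y i)) = s := by
    simp_rw [hy]
    exact (s.equivFin.symm.surjective.range_comp (fun v : s => (v : Ω[Z⁄k]))).trans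
      Subtype.range_coe
  let p : (Fin s.card → Z) →ₗ[Z] Ω[Z⁄k] := Fintype.linearCombination Z
    fun i => KaehlerDifferential.D k Z (y i)
  have hp : Function.Surjective p := by
    rw [← LinearMap.range_eq_top, Fintype.range_linearCombination, hrange, hspan]
  obtain ⟨σ, hσ⟩ := Module.projective_lifting_property p LinearMap.id hp
  refine ⟨s.card, ⟨⟨y, fun i => (LinearMap.proj i ∘ₗ σ).compDer (KaehlerDifferential.D k Z),
    fun x => ?_⟩⟩⟩
  exact (LinearMap.congr_fun hσ (KaehlerDifferential.D k Z x)).symm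


theorem theoremT {k Z A : Type*} [Field k] [IsAlgClosed k]
    [CommRing Z] [Algebra k Z] [Algebra.FiniteType k Z] [IsReduced Z] [IsRegularRing Z]
    [PoissonAlgebra k Z]
    [Ring A] [Algebra k A] [Algebra Z A] [IsScalarTower k Z A] [PoissonOrder k Z A]
    (hLie : ∀ (x y : Z) (a : A),
      PoissonOrder.ham (k := k) (PoissonAlgebra.bracket (k := k) x y) a =
        PoissonOrder.ham (k := k) x (PoissonOrder.ham (k := k) y a)
          - PoissonOrder.ham (k := k) y (PoissonOrder.ham (k := k) x a)) :
    (∃ φ : A ⊗[Z] SymmetricAlgebra Z (Ω[Z⁄k]) →ₐ[k]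
        FilteredAlgebra.Gr (PoissonEnv.filt k Z A),
      PoissonEnv.IsNatural k Z A φ ∧ (∀ ψ, PoissonEnv.IsNatural k Z A ψ → ψ = φ) ∧
      Function.Bijective φ) ∧
    (∃ f : A ⊗[Z] PoissonEnv k Z Z ≃+ PoissonEnv k Z A,
      (∀ (a : A) (u : PoissonEnv k Z Z),
        f (a ⊗ₜ u) = PoissonEnv.alpha k Z A a * PoissonEnv.ofBase k Z A u) ∧
      (∀ (a : A) (t : A ⊗[Z] PoissonEnv k Z Z),
        f (a • t) = PoissonEnv.alpha k Z A a * f t) ∧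
      (∀ (t : A ⊗[Z] PoissonEnv k Z Z) (u : PoissonEnv k Z Z),
        f (LinearMap.lTensor A (LinearMap.mulRight Z u) t) =
          f t * PoissonEnv.ofBase k Z A u)) ∧
    (∃ g : PoissonEnvRight k Z ⊗[Z] A ≃+ PoissonEnv k Z A,
      (∀ (u : PoissonEnv k Z Z) (a : A),
        g (PoissonEnvRight.of k Z u ⊗ₜ a) =
          PoissonEnv.ofBase k Z A u * PoissonEnv.alpha k Z A a) ∧
      (∀ (u : PoissonEnv k Z Z) (t : PoissonEnvRight k Z ⊗[Z] A),
        g (u • t) = PoissonEnv.ofBase k Z A u * g t) ∧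
      (∀ (t : PoissonEnvRight k Z ⊗[Z] A) (a : A),
        g (LinearMap.lTensor (PoissonEnvRight k Z) (LinearMap.mulRight Z a) t) =
          g t * PoissonEnv.alpha k Z A a)) := by
  obtain ⟨r, ⟨F⟩⟩ := CotangentFrame.nonempty_of_projective k Z
  obtain ⟨φ, hφ⟩ := PoissonEnv.exists_isNatural k Z A
  refine ⟨⟨φ, hφ, fun ψ hψ => PoissonEnv.IsNatural.eq hψ hφ,
      PoissonEnv.IsNatural.injective hLie F hφ, PoissonEnv.IsNatural.surjective hφ⟩,
    ⟨AddEquiv.ofBijective (PoissonEnv.ofTensor k Z A) (PoissonEnv.ofTensor_bijective hLie),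
      PoissonEnv.ofTensor_tmul, PoissonEnv.ofTensor_smul, PoissonEnv.ofTensor_mulRight⟩,
    ⟨AddEquiv.ofBijective (PoissonEnvRight.ofTensor k Z A)
        (PoissonEnvRight.ofTensor_bijective hLie),
      PoissonEnvRight.ofTensor_tmul, PoissonEnvRight.ofTensor_smul,
      PoissonEnvRight.ofTensor_mulRight⟩⟩
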